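/- Let $0<\alpha<1$ and let $f(z)=z+\sum_{n=2}^\infty a_nz^n$ be a normalized convex univalent function in the unit disc $\mathbb D$ (holomorphic and injective in $\mathbb D$ with $f(\mathbb D)$ convex); put $a_1=1$. Let $$D^\alpha f(z)=\frac1{\Gamma(1-\alpha)}\frac{d}{dz}\int_0^z (z-t)^{-\alpha}f(t)\,dt$$ be its Riemann–Liouville fractional derivative, a multivalued function on $\mathbb D\setminus\{0\}$ whose branches differ by the constant unimodular factors $e^{-2\pi i k\alpha}$, $k\in\mathbb Z$ (so that $|D^\alpha f(z)|$ is single-valued). The limit $D^\alpha f(0):=\lim_{z\to0}D^\alpha f(z)$ exists; let $D^\alpha f(\mathbb D)$ be the set of the values of all branches together with $D^\alpha f(0)$. The limit $$L(\alpha)=\lim_{t\to1^-}\left|\frac{t^{1-\alpha}}{\Gamma(2-\alpha)}\;{}_2F_1(1,2;2-\alpha;-t)\right|$$ exists, and the equation $$\sum_{n=1}^\infty\frac{\Gamma(n+1)}{\Gamma(n+1-\alpha)}\,r^{n-\alpha}=L(\alpha)$$ has a smallest positive solution $r=P(\alpha)$, which is less than $1$. For all $0\le r\le P(\alpha)$ the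 series below converges and $$\sum_{n=1}^\infty\frac{\Gamma(n+1)}{\Gamma(n+1-\alpha)}\,|a_n|\,r^{n-\alpha}\le \mathrm{dist}\big(D^\alpha f(0),\partial D^\alpha f(\mathbb D)\big)$$ (the distance to the empty set being $+\infty$). Moreover the same sum is at most $\liminf_{|z|\to1^-}|D^\alpha f(z)-D^\alpha f(0)|$. -/

import Mathlib

open Filter Topology

/-- The class of normalized convex univalent functions on the open unit disc: `f` is holomorphic and
injective there, its image of the disc is convex, and `f 0 = 0`, `f' 0 = 1`. -/
structure IsNormalizedConvexUnivalent (f : ℂ → ℂ) : Prop where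
  holomorphic : DifferentiableOn ℂ f (Metric.ball 0 1)
  injective : Set.InjOn f (Metric.ball 0 1)
  convex_image : Convex ℝ (f '' Metric.ball 0 1)
  map_zero : f 0 = 0
  deriv_zero : deriv f 0 = 1

/-- `∫_0^z (z - t)^(-α) f(t) dt` along the segment `t = u z`, `0 ≤ u ≤ 1`, as a function of
`ζ = log z`.  As `z ↦ z ^ (-α)` is multivalued, the point `z ≠ 0` is given by a logarithm `ζ`,
`z = exp ζ`, and `(z - t)^(-α) = z^(-α) (1 - u)^(-α)` with `z^(-α) = exp (-α ζ)`. -/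
noncomputable def rlPrimitive (α : ℝ) (f : ℂ → ℂ) (ζ : ℂ) : ℂ :=
  ∫ u in (0 : ℝ)..1,
    (Complex.exp (-(α : ℂ) * ζ) * (((1 - u) ^ (-α) : ℝ) : ℂ)) * f ((u : ℂ) * Complex.exp ζ)
      * Complex.exp ζ

/-- The Riemann–Liouville fractional derivative
`D^α f (z) = (1 / Γ(1 - α)) (d/dz) ∫_0^z (z - t)^(-α) f(t) dt` at the point `z = exp ζ`, on the
branch given by `ζ`; here `d/dz = exp (-ζ) d/dζ`.  The values of the multivalued function
`D^α f` at `z` are the values at all logarithms `ζ` of `z`. -/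
noncomputable def fracDeriv (α : ℝ) (f : ℂ → ℂ) (ζ : ℂ) : ℂ :=
  ((Real.Gamma (1 - α) : ℝ) : ℂ)⁻¹ * (Complex.exp (-ζ) * deriv (rlPrimitive α f) ζ)

/-- The logarithms of the points of the punctured open unit disc. -/
def logDisc : Set ℂ := {ζ : ℂ | ζ.re < 0}

/-- `z → 0`, for `z = exp ζ`, over all branches. -/
def toCentre : Filter ℂ := comap Complex.re atBot

/-- `|z| → 1` from inside the disc, for `z = exp ζ`, in all directions and over all branches. -/
def toCircle : Filter ℂ := comap Complex.re (𝓝[<] 0)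

/-- The image `D^α f (𝔻)` of the whole disc (all branches), with the value `w₀` at the centre. -/
noncomputable def fracImage (α : ℝ) (f : ℂ → ℂ) (w₀ : ℂ) : Set ℂ :=
  insert w₀ (fracDeriv α f '' logDisc)

/-- The term `Γ(n+1) / Γ(n+1-α) * r^(n-α)`. -/
noncomputable def fracTerm (α r : ℝ) (n : ℕ) : ℝ :=
  Real.Gamma ((n : ℝ) + 1) / Real.Gamma ((n : ℝ) + 1 - α) * r ^ ((n : ℝ) - α)

/-- The majorant series `∑_{n ≥ 1} Γ(n+1) / Γ(n+1-α) |a_n| r^(n-α)`. -/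
noncomputable def fracMajorant (α : ℝ) (a : ℕ → ℂ) (r : ℝ) : ℝ :=
  ∑' n : ℕ, fracTerm α r (n + 1) * ‖a (n + 1)‖

/-! Differentiation under the integral sign and an integration by parts give D^α f(z) = z^(1-α)
Γ(1-α)⁻¹ ∫₀¹ (1-u)^(-α) f'(uz) du (`fracDeriv_eq`). Everything is compared with L = Γ(1-α)⁻¹ ∫₀¹
(1-u)^(-α) (1+u)^(-2) du, which Euler's integral formula identifies with the hypergeometric limit.

Upper side: |a_n| ≤ 1, because averaging f over the n-th roots of unity produces a function
subordinate to f with linear coefficient a_n. So the majorant series is at most the one for z/(1-z),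
whose sum is strictly increasing in r and reaches L at P (`exists_radius`).

Lower side: f maps the disc |w| < |z| onto a convex set (`convex_image_ball`), so a supporting line
at f(z) gives some n for which (f(z) - f(w)) n has positive real part there. Harnack's inequality
bounds this real part below along the radius. As the weight (1-u)^(-α) increases, integration by
parts carries the bound over to the integral of f'. The result is |D^α f(z)| ≥ |z|^(1-α) L
(`le_norm_fracDeriv`), which settles the liminf.

For the distance, D^α f tends to 0 at the centre, and values of modulus below L stay away from |z| =
1. Hence the image is open and relatively closed in the punctured disc of radius L, and contains it
(`ball_subset_fracImage`). The infinitely many branches do no harm: they differ by rotations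
preserving the image, so a compact rectangle of logarithms suffices. -/

/-! ### Convex univalent functions: subordination and coefficient bounds -/

/-- A normalized convex univalent function is an open map on the disc. -/
theorem isOpen_image_of_isNormalizedConvexUnivalent {f : ℂ → ℂ}
    (hf : IsNormalizedConvexUnivalent f) {s : Set ℂ} (hs : s ⊆ Metric.ball 0 1)
    (hso : IsOpen s) : IsOpen (f '' s) := by
  have han : AnalyticOnNhd ℂ f (Metric.ball 0 1) :=
    hf.holomorphic.analyticOnNhd Metric.isOpen_ball
  rcases han.is_constant_or_isOpen (convex_ball _ _).isPreconnected with ⟨w, hw⟩ | h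
  · exfalso
    have h0 : (0 : ℂ) ∈ Metric.ball (0 : ℂ) 1 := by simp
    have h1 : (1 / 2 : ℂ) ∈ Metric.ball (0 : ℂ) 1 := by
      simp only [Metric.mem_ball, dist_zero_right]; norm_num
    have := hf.injective h0 h1 ((hw _ h0).trans (hw _ h1).symm)
    norm_num at this
  · exact h s hs hso

/-- An inverse of a normalized convex univalent function is holomorphic. -/
theorem IsNormalizedConvexUnivalent.exists_inverse {f : ℂ → ℂ}
    (hf : IsNormalizedConvexUnivalent f) :
    ∃ F : ℂ → ℂ, DifferentiableOn ℂ F (f '' Metric.ball 0 1) ∧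
      (∀ z ∈ Metric.ball (0 : ℂ) 1, F (f z) = z) ∧
      ∀ w ∈ f '' Metric.ball 0 1, F w ∈ Metric.ball (0 : ℂ) 1 ∧ f (F w) = w := by
  set D : Set ℂ := Metric.ball 0 1 with hD
  set F := Function.invFunOn f D with hF
  have hinv : ∀ z ∈ D, F (f z) = z := hf.injective.leftInvOn_invFunOn
  have hmem : ∀ w ∈ f '' D, F w ∈ D ∧ f (F w) = w := fun w hw =>
    ⟨Function.invFunOn_mem hw, Function.invFunOn_eq hw⟩
  have hDo : IsOpen D := Metric.isOpen_ball
  have hΩ : IsOpen (f '' D) := isOpen_image_of_isNormalizedConvexUnivalent hf subset_rfl hDo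
  have hcont : ∀ w ∈ f '' D, ContinuousAt F w := by
    intro w hw
    rw [ContinuousAt, tendsto_def]
    intro s hs
    obtain ⟨t, hts, hto, hwt⟩ := mem_nhds_iff.1 (inter_mem hs (hDo.mem_nhds (hmem w hw).1))
    refine mem_of_superset ((isOpen_image_of_isNormalizedConvexUnivalent hf
      (fun x hx => (hts hx).2) hto).mem_nhds ⟨_, hwt, (hmem w hw).2⟩) ?_
    rintro _ ⟨x, hx, rfl⟩
    change F (f x) ∈ s
    rw [hinv x (hts hx).2]
    exact (hts hx).1
  have hder : AnalyticOnNhd ℂ (deriv f) D := (hf.holomorphic.analyticOnNhd hDo).deriv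
  have hdiff : ∀ w ∈ f '' D, deriv f (F w) ≠ 0 → DifferentiableAt ℂ F w := by
    intro w hw h
    have h1 : HasDerivAt f (deriv f (F w)) (F w) :=
      (hf.holomorphic.differentiableAt (hDo.mem_nhds (hmem w hw).1)).hasDerivAt
    refine (HasDerivAt.of_local_left_inverse (hcont w hw) h1 h ?_).differentiableAt
    filter_upwards [hΩ.mem_nhds hw] with v hv using (hmem v hv).2
  refine ⟨F, ?_, hinv, hmem⟩
  intro w hw
  refine DifferentiableAt.differentiableWithinAt (AnalyticAt.differentiableAt ?_)
  -- Zeros of f' are isolated, so any point where the inverse function rule fails is a removable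
  -- singularity of the continuous inverse.
  refine Complex.analyticAt_of_differentiable_on_punctured_nhds_of_continuousAt ?_ (hcont w hw)
  rcases (hder _ (hmem w hw).1).eventually_eq_zero_or_eventually_ne_zero with h | h
  · exfalso
    have := hder.eqOn_zero_of_preconnected_of_eventuallyEq_zero
      (convex_ball _ _).isPreconnected (hmem w hw).1 h (show (0 : ℂ) ∈ D by simp [hD])
    simp [hf.deriv_zero] at this
  · have htend : Tendsto F (𝓝[≠] w) (𝓝[≠] (F w)) := by
      refine tendsto_nhdsWithin_iff.2 ⟨(hcont w hw).tendsto.mono_left nhdsWithin_le_nhds, ?_⟩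
      filter_upwards [self_mem_nhdsWithin, nhdsWithin_le_nhds (hΩ.mem_nhds hw)] with v hv hv'
      intro h
      apply hv
      have h2 : F v = F w := h
      rw [Set.mem_singleton_iff, ← (hmem v hv').2, h2, (hmem w hw).2]
    filter_upwards [htend.eventually h, nhdsWithin_le_nhds (hΩ.mem_nhds hw)] with v h1 h2
    exact hdiff v h2 h1

/-- Schwarz lemma for functions subordinate to a convex univalent function: `g = f ∘ ω` with
`‖ω z‖ ≤ ‖z‖`, and `‖g' 0‖ ≤ 1`. -/
theorem IsNormalizedConvexUnivalent.subordination {f g : ℂ → ℂ}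
    (hf : IsNormalizedConvexUnivalent f) (hg : DifferentiableOn ℂ g (Metric.ball 0 1))
    (hmaps : Set.MapsTo g (Metric.ball 0 1) (f '' Metric.ball 0 1)) (h0 : g 0 = 0) :
    (∀ z ∈ Metric.ball (0 : ℂ) 1, ∃ w : ℂ, ‖w‖ ≤ ‖z‖ ∧ f w = g z) ∧ ‖deriv g 0‖ ≤ 1 := by
  obtain ⟨F, hFd, hinv, hmem⟩ := hf.exists_inverse
  have h0D : (0 : ℂ) ∈ Metric.ball (0 : ℂ) 1 := by simp
  have hd : DifferentiableOn ℂ (fun z => F (g z)) (Metric.ball 0 1) := hFd.comp hg hmaps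
  have hz : F (g 0) = 0 := by
    have := hinv 0 h0D
    rw [hf.map_zero] at this
    rwa [h0]
  have hm : Set.MapsTo (fun z => F (g z)) (Metric.ball 0 1) (Metric.closedBall 0 1) :=
    fun z hz => Metric.ball_subset_closedBall (hmem _ (hmaps hz)).1
  refine ⟨fun z hz' => ⟨F (g z), ?_, (hmem _ (hmaps hz')).2⟩, ?_⟩
  · exact Complex.norm_le_norm_of_mapsTo_ball hd hm hz (by simpa using hz')
  · have h1 := Complex.norm_deriv_le_one_of_mapsTo_ball hd (by rwa [hz]) one_pos
    have h2 : HasDerivAt (fun z => F (g z)) (deriv (fun z => F (g z)) 0) 0 :=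
      (hd.differentiableAt (Metric.isOpen_ball.mem_nhds h0D)).hasDerivAt
    have h3 : HasDerivAt f 1 (F (g 0)) := by
      rw [hz, ← hf.deriv_zero]
      exact (hf.holomorphic.differentiableAt (Metric.isOpen_ball.mem_nhds h0D)).hasDerivAt
    have h4 := h3.comp (0 : ℂ) h2
    have h5 : g =ᶠ[𝓝 0] f ∘ fun z => F (g z) := by
      filter_upwards [Metric.isOpen_ball.mem_nhds h0D] with z hz'
      exact ((hmem _ (hmaps hz')).2).symm
    rw [(h4.congr_of_eventuallyEq h5).deriv, one_mul]
    exact h1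

/-- A convex univalent function maps concentric smaller discs onto convex sets. -/
theorem IsNormalizedConvexUnivalent.convex_image_ball {f : ℂ → ℂ}
    (hf : IsNormalizedConvexUnivalent f) {ρ : ℝ} (hρ : ρ ≤ 1) :
    Convex ℝ (f '' Metric.ball 0 ρ) := by
  have key : ∀ z₁ z₂ : ℂ, ‖z₁‖ ≤ ‖z₂‖ → ‖z₂‖ < ρ → ∀ s t : ℝ, 0 ≤ s → 0 ≤ t → s + t = 1 →
      s • f z₁ + t • f z₂ ∈ f '' Metric.ball 0 ρ := by
    intro z₁ z₂ h12 h2 s t hs ht hst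
    have hc : ‖z₁ / z₂‖ ≤ 1 := by
      rw [norm_div]; exact div_le_one_of_le₀ h12 (norm_nonneg _)
    have hmap : Set.MapsTo (fun z : ℂ => z₁ / z₂ * z) (Metric.ball 0 1) (Metric.ball 0 1) := by
      intro z hz
      simp only [Metric.mem_ball, dist_zero_right, norm_mul] at hz ⊢
      nlinarith [norm_nonneg z]
    -- This combination stays in the convex set f(𝔻), and at z₂ it equals the required point;
    -- Schwarz places that point in the image of |w| ≤ |z₂|.
    have := (hf.subordination (g := fun z => s • f (z₁ / z₂ * z) + t • f z) ?_ ?_ ?_).1 z₂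
      (by simpa using h2.trans_le hρ)
    · obtain ⟨w, hw, hfw⟩ := this
      refine ⟨w, by simpa using hw.trans_lt h2, ?_⟩
      rw [hfw]
      -- If z₂ = 0 the quotient is 0 by convention, and ‖z₁‖ ≤ ‖z₂‖ forces z₁ = 0 too.
      by_cases h : z₂ = 0
      · have : z₁ = 0 := by simpa [h] using h12
        simp [h, this]
      · simp [div_mul_cancel₀ _ h]
    · exact ((hf.holomorphic.comp (by fun_prop) hmap).const_smul s).add
        (hf.holomorphic.const_smul t)
    · intro z hz
      exact hf.convex_image ⟨_, hmap hz, rfl⟩ ⟨z, hz, rfl⟩ hs ht hst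
    · simp [hf.map_zero]
  rintro _ ⟨z₁, h1, rfl⟩ _ ⟨z₂, h2, rfl⟩ s t hs ht hst
  simp only [Metric.mem_ball, dist_zero_right] at h1 h2
  rcases le_total ‖z₁‖ ‖z₂‖ with h | h
  · exact key z₁ z₂ h h2 s t hs ht hst
  · rw [add_comm]; exact key z₂ z₁ h h1 t s ht hs (by rwa [add_comm])

/-- Averaging a power series over the rotations by `n`-th roots of unity keeps exactly the terms
of degree divisible by `n`. -/
theorem hasSum_average_rootsOfUnity {f : ℂ → ℂ} {a : ℕ → ℂ}
    (ha : ∀ z ∈ Metric.ball (0 : ℂ) 1, HasSum (fun n : ℕ => a n * z ^ n) (f z)) {n : ℕ}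
    (hn : n ≠ 0) {ω : ℂ} (hω : IsPrimitiveRoot ω n) {w : ℂ} (hw : ‖w‖ < 1) :
    HasSum (fun k : ℕ => a (n * k) * (w ^ n) ^ k)
      (∑ j ∈ Finset.range n, (n : ℝ)⁻¹ • f (ω ^ j * w)) := by
  have hωn : ‖ω‖ = 1 := hω.norm'_eq_one hn
  have h1 : HasSum (fun m : ℕ => ∑ j ∈ Finset.range n, (n : ℝ)⁻¹ • (a m * (ω ^ j * w) ^ m))
      (∑ j ∈ Finset.range n, (n : ℝ)⁻¹ • f (ω ^ j * w)) := by
    refine hasSum_sum fun j _ => (ha _ ?_).const_smul _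
    simpa [hωn] using hw
  have hn' : (n : ℂ) ≠ 0 := by exact_mod_cast hn
  have h2 : ∀ m : ℕ, ¬ n ∣ m →
      ∑ j ∈ Finset.range n, (n : ℝ)⁻¹ • (a m * (ω ^ j * w) ^ m) = 0 := by
    intro m hm
    have : ∑ j ∈ Finset.range n, (ω ^ m) ^ j = 0 := by
      have hne : ω ^ m ≠ 1 := fun h => hm ((hω.pow_eq_one_iff_dvd m).1 h)
      rw [geom_sum_eq hne, ← pow_mul, mul_comm, pow_mul, hω.pow_eq_one]; simp
    calc _ = ((n : ℝ)⁻¹ : ℝ) • (a m * w ^ m * ∑ j ∈ Finset.range n, (ω ^ m) ^ j) := by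
          rw [Finset.mul_sum, Finset.smul_sum]
          refine Finset.sum_congr rfl fun j _ => ?_
          congr 1
          rw [mul_pow, ← pow_mul, ← pow_mul, mul_comm m j]; ring
      _ = 0 := by simp [this]
  have hinj : Function.Injective fun k : ℕ => n * k := fun _ _ h => Nat.eq_of_mul_eq_mul_left
    (Nat.pos_of_ne_zero hn) h
  rw [← hinj.hasSum_iff] at h1
  · convert h1 using 2 with k
    have : ∀ j ∈ Finset.range n,
        (n : ℝ)⁻¹ • (a (n * k) * (ω ^ j * w) ^ (n * k)) =
          (n : ℂ)⁻¹ * (a (n * k) * (w ^ n) ^ k) := by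
      intro j _
      rw [mul_pow, ← pow_mul, ← pow_mul, mul_comm j, mul_assoc, pow_mul, hω.pow_eq_one,
        one_pow, one_mul, Complex.real_smul]
      push_cast; rfl
    simp only [Function.comp_apply]
    rw [Finset.sum_congr rfl this, Finset.sum_const, Finset.card_range, nsmul_eq_mul,
      mul_inv_cancel_left₀ hn']
  · intro m hm
    exact h2 m fun ⟨k, hk⟩ => hm ⟨k, hk.symm⟩

/-- A convergent power series on the unit disc is holomorphic there. -/
theorem differentiableOn_of_hasSum {g : ℂ → ℂ} {b : ℕ → ℂ}
    (hb : ∀ z ∈ Metric.ball (0 : ℂ) 1, HasSum (fun n : ℕ => b n * z ^ n) (g z)) :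
    DifferentiableOn ℂ g (Metric.ball 0 1) := by
  intro z hz
  obtain ⟨r, hzr, hr1⟩ := exists_between (show ‖z‖ < 1 by simpa using hz)
  have hr0 : 0 ≤ r := (norm_nonneg z).trans hzr.le
  have hs : Summable fun n : ℕ => ‖b n‖ * r ^ n := by
    have := (hb (r : ℂ) (by simpa [abs_of_nonneg hr0] using hr1)).summable.norm
    simpa [abs_of_nonneg hr0] using this
  have h := Complex.differentiableOn_tsum_of_summable_norm (F := fun n w => b n * w ^ n)
    (U := Metric.ball 0 r) hs (fun n => by fun_prop) Metric.isOpen_ball (by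
      intro n w hw
      have : ‖w‖ ≤ r := by simpa using (Metric.mem_ball.1 hw).le
      rw [norm_mul, norm_pow]; gcongr)
  have hmem : Metric.ball (0 : ℂ) r ∈ 𝓝 z := Metric.isOpen_ball.mem_nhds (by simpa using hzr)
  refine ((h.differentiableAt hmem).congr_of_eventuallyEq ?_).differentiableWithinAt
  filter_upwards [hmem] with w hw
  refine ((hb w ?_).tsum_eq).symm
  exact Metric.ball_subset_ball hr1.le hw

/-- The derivative at the centre is the linear coefficient. -/
theorem deriv_zero_of_hasSum {g : ℂ → ℂ} {b : ℕ → ℂ}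
    (hb : ∀ z ∈ Metric.ball (0 : ℂ) 1, HasSum (fun n : ℕ => b n * z ^ n) (g z)) :
    deriv g 0 = b 1 := by
  have h : HasFPowerSeriesAt g (FormalMultilinearSeries.ofScalars ℂ b) 0 := by
    rw [hasFPowerSeriesAt_iff]
    filter_upwards [Metric.ball_mem_nhds (0 : ℂ) one_pos] with z hz
    simpa [mul_comm] using hb z hz
  simpa using h.deriv

/-- Coefficients of normalized convex univalent functions are bounded by one. -/
theorem IsNormalizedConvexUnivalent.norm_coeff_le_one {f : ℂ → ℂ} {a : ℕ → ℂ}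
    (hf : IsNormalizedConvexUnivalent f)
    (ha : ∀ z ∈ Metric.ball (0 : ℂ) 1, HasSum (fun n : ℕ => a n * z ^ n) (f z)) {n : ℕ}
    (hn : n ≠ 0) : ‖a n‖ ≤ 1 := by
  have hω := Complex.isPrimitiveRoot_exp n hn
  set ω := Complex.exp (2 * Real.pi * Complex.I / n)
  have hωn : ‖ω‖ = 1 := hω.norm'_eq_one hn
  have hn' : (n : ℝ) ≠ 0 := by exact_mod_cast hn
  have hroot : ∀ z ∈ Metric.ball (0 : ℂ) 1, ∃ w : ℂ, ‖w‖ < 1 ∧ w ^ n = z := by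
    intro z hz
    obtain ⟨w, hw⟩ := IsAlgClosed.exists_pow_nat_eq z (Nat.pos_of_ne_zero hn)
    refine ⟨w, ?_, hw⟩
    have : ‖w‖ ^ n < 1 := by rw [← norm_pow, hw]; simpa using hz
    by_contra! h
    exact absurd this (not_lt.2 (one_le_pow₀ h))
  have hsum : ∀ z ∈ Metric.ball (0 : ℂ) 1,
      HasSum (fun k : ℕ => a (n * k) * z ^ k) (∑' k : ℕ, a (n * k) * z ^ k) := by
    intro z hz
    obtain ⟨w, hw, rfl⟩ := hroot z hz
    exact (hasSum_average_rootsOfUnity ha hn hω hw).summable.hasSum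
  have ha0 : a 0 = 0 := by
    have := ha 0 (by simp)
    rw [hf.map_zero] at this
    refine (hasSum_single 0 ?_).unique this |>.symm ▸ ?_
    all_goals simp +contextual
  -- With z = w^n, this series is the mean of the values f(ω^j w), hence a point of the convex
  -- image; its derivative at 0 is a_n.
  have := (hf.subordination (g := fun z => ∑' k : ℕ, a (n * k) * z ^ k)
    (differentiableOn_of_hasSum hsum) ?_ ?_).2
  · rw [deriv_zero_of_hasSum hsum] at this
    simpa using this
  · intro z hz
    obtain ⟨w, hw, rfl⟩ := hroot z hz
    have h := (hasSum_average_rootsOfUnity ha hn hω hw).tsum_eq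
    simp only [h]
    refine hf.convex_image.sum_mem (fun _ _ => by positivity) ?_ fun j _ => ⟨_, ?_, rfl⟩
    · simp [hn']
    · simpa [hωn] using hw
  · have : ∀ k : ℕ, a (n * k) * (0 : ℂ) ^ k = 0 := by
      rintro (_ | k) <;> simp [ha0]
    simp [this]

/-! ### Support lines and the lower bound for the weighted radial integral -/

/-- Harnack's inequality and the derivative bound for functions with positive real part. -/
theorem harnack_of_re_pos {h : ℂ → ℂ} {ρ : ℝ} (hρ : 0 < ρ)
    (hd : DifferentiableOn ℂ h (Metric.ball 0 ρ)) (hpos : ∀ z ∈ Metric.ball (0 : ℂ) ρ, 0 < (h z).re) :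
    ‖deriv h 0‖ * ρ ≤ 2 * (h 0).re ∧
      ∀ z ∈ Metric.ball (0 : ℂ) ρ, (h 0).re * (ρ - ‖z‖) ≤ (h z).re * (ρ + ‖z‖) := by
  set c : ℝ := (h 0).re with hc
  set y : ℝ := (h 0).im with hy
  have h0D : (0 : ℂ) ∈ Metric.ball (0 : ℂ) ρ := by simpa using hρ
  have hc0 : 0 < c := hpos 0 h0D
  -- Making the value at 0 real lets the Cayley transform q below vanish at 0, so that Schwarz's
  -- lemma gives both estimates.
  set k : ℂ → ℂ := fun z => h z - y * Complex.I with hk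
  have hk0 : k 0 = c := by
    simp only [hk, hc, hy]
    apply Complex.ext <;> simp
  have hkre : ∀ z, (k z).re = (h z).re := by intro z; simp [hk]
  have hkd : DifferentiableOn ℂ k (Metric.ball 0 ρ) := hd.sub_const _
  have hne : ∀ z ∈ Metric.ball (0 : ℂ) ρ, k z + c ≠ 0 := by
    intro z hz h0
    have := congrArg Complex.re h0
    simp only [Complex.add_re, hkre, Complex.ofReal_re, Complex.zero_re] at this
    linarith [hpos z hz]
  set q : ℂ → ℂ := fun z => (k z - c) / (k z + c) with hq
  have hq0 : q 0 = 0 := by simp [hq, hk0]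
  have hqd : DifferentiableOn ℂ q (Metric.ball 0 ρ) :=
    (hkd.sub_const _).div (hkd.add_const _) hne
  have hsq : ∀ w : ℂ, ‖w‖ ^ 2 = w.re ^ 2 + w.im ^ 2 := by
    intro w; rw [Complex.sq_norm, Complex.normSq_apply]; ring
  have hqm : Set.MapsTo q (Metric.ball 0 ρ) (Metric.closedBall (q 0) 1) := by
    intro z hz
    rw [hq0, mem_closedBall_zero_iff]
    simp only [hq, norm_div]
    refine div_le_one_of_le₀ ?_ (norm_nonneg _)
    refine le_of_sq_le_sq ?_ (norm_nonneg _)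
    rw [hsq, hsq]
    simp only [Complex.sub_re, Complex.add_re, Complex.sub_im, Complex.add_im, hkre,
      Complex.ofReal_re, Complex.ofReal_im]
    nlinarith [hpos z hz]
  constructor
  · have h1 := Complex.norm_deriv_le_div_of_mapsTo_ball hqd hqm hρ
    have h2 : HasDerivAt h (deriv h 0) 0 :=
      (hd.differentiableAt (Metric.isOpen_ball.mem_nhds h0D)).hasDerivAt
    have h3 : HasDerivAt k (deriv h 0) 0 := h2.sub_const _
    have h4 := ((h3.sub_const (c : ℂ)).fun_div (h3.add_const (c : ℂ)) (hne 0 h0D)).deriv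
    have hcc : (c : ℂ) ≠ 0 := by exact_mod_cast hc0.ne'
    have h5 : deriv q 0 = deriv h 0 / (2 * c) := by
      rw [hq, h4, hk0]; field_simp; ring
    rw [h5, norm_div, norm_mul, Complex.norm_real, Real.norm_of_nonneg hc0.le,
      Complex.norm_ofNat, div_le_div_iff₀ (by positivity) hρ] at h1
    linarith
  · intro z hz
    have h1 := Complex.dist_le_div_mul_dist_of_mapsTo_ball hqd hqm hz
    rw [hq0, dist_zero_right, dist_zero_right] at h1
    simp only [hq, norm_div] at h1
    have hz' : ‖z‖ < ρ := by simpa using hz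
    rw [div_le_iff₀ (norm_pos_iff.2 (hne z hz))] at h1
    have h2 : ‖k z - c‖ * ρ ≤ ‖z‖ * ‖k z + c‖ := by
      calc ‖k z - c‖ * ρ ≤ (1 / ρ * ‖z‖ * ‖k z + c‖) * ρ := by gcongr
        _ = _ := by field_simp
    have h3 : (‖k z - c‖ * ρ) ^ 2 ≤ (‖z‖ * ‖k z + c‖) ^ 2 := by gcongr
    rw [mul_pow, mul_pow, hsq (k z - c), hsq (k z + c)] at h3
    simp only [Complex.sub_re, Complex.add_re, Complex.sub_im, Complex.add_im, hkre,
      Complex.ofReal_re, Complex.ofReal_im, sub_zero, add_zero] at h3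
    have hx := hpos z hz
    -- The imaginary part enters both sides, with coefficients ρ² and ‖z‖² ≤ ρ², and can be dropped.
    have h4 : ((c - (h z).re) * ρ) ^ 2 ≤ (‖z‖ * ((h z).re + c)) ^ 2 := by
      have : ‖z‖ ^ 2 ≤ ρ ^ 2 := by gcongr
      nlinarith [sq_nonneg (k z).im]
    have h5 := le_of_sq_le_sq h4 (by positivity)
    nlinarith

theorem intervalIntegrable_one_sub_rpow {α : ℝ} (hα1 : α < 1) :
    IntervalIntegrable (fun u : ℝ => (1 - u) ^ (-α)) MeasureTheory.volume 0 1 := by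
  have h : IntervalIntegrable (fun u : ℝ => u ^ (-α)) MeasureTheory.volume 0 1 :=
    intervalIntegral.intervalIntegrable_rpow' (by linarith)
  simpa using (h.comp_sub_left 1).symm

theorem intervalIntegrable_one_sub_rpow_mul {α : ℝ} (hα1 : α < 1) {φ : ℝ → ℝ}
    (hφ : ContinuousOn φ (Set.Icc 0 1)) :
    IntervalIntegrable (fun u : ℝ => (1 - u) ^ (-α) * φ u) MeasureTheory.volume 0 1 :=
  (intervalIntegrable_one_sub_rpow hα1).mul_continuousOn
    (by rwa [Set.uIcc_of_le zero_le_one])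

theorem intervalIntegrable_one_sub_rpow_mul_complex {α : ℝ} (hα1 : α < 1) {φ : ℝ → ℂ}
    (hφ : ContinuousOn φ (Set.Icc 0 1)) :
    IntervalIntegrable (fun u : ℝ => (((1 - u) ^ (-α) : ℝ) : ℂ) * φ u)
      MeasureTheory.volume 0 1 := by
  have h : IntervalIntegrable (fun u : ℝ => (((1 - u) ^ (-α) : ℝ) : ℂ))
      MeasureTheory.volume 0 1 :=
    ⟨(intervalIntegrable_one_sub_rpow hα1).1.ofReal, (intervalIntegrable_one_sub_rpow hα1).2.ofReal⟩
  exact h.mul_continuousOn (by rwa [Set.uIcc_of_le zero_le_one])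

/-- Integration by parts against the increasing weight `(1 - u)^(-α)`. -/
theorem integral_one_sub_rpow_mul_deriv_nonneg {α : ℝ} (hα0 : 0 < α) (hα1 : α < 1)
    {χ χ' : ℝ → ℝ} (hχ : ∀ u ∈ Set.Icc (0 : ℝ) 1, HasDerivAt χ (χ' u) u)
    (hχ' : ContinuousOn χ' (Set.Icc 0 1)) (hχ1 : χ 1 = 0)
    (hneg : ∀ u ∈ Set.Icc (0 : ℝ) 1, χ u ≤ 0) :
    0 ≤ ∫ u in (0 : ℝ)..1, (1 - u) ^ (-α) * χ' u := by
  -- Since χ 1 = 0, the product (1-u)^(-α) χ(u) equals -(1-u)^(1-α) times the difference quotient of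
  -- χ at 1, so it is continuous up to u = 1 and vanishes there.
  have hds : ContinuousOn (dslope χ 1) (Set.Icc 0 1) := by
    intro u hu
    by_cases h : u = 1
    · subst h
      exact (continuousAt_dslope_same.2 (hχ 1 hu).differentiableAt).continuousWithinAt
    · exact ((continuousAt_dslope_of_ne h).2 (hχ u hu).continuousAt).continuousWithinAt
  have hcont : ContinuousOn (fun u : ℝ => (1 - u) ^ (-α) * χ u) (Set.Icc 0 1) := by
    have : ContinuousOn (fun u : ℝ => -((1 - u) ^ (1 - α) * dslope χ 1 u)) (Set.Icc 0 1) := by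
      refine (ContinuousOn.mul ?_ hds).neg
      exact ContinuousOn.rpow_const (by fun_prop) fun u _ => Or.inr (by linarith)
    refine this.congr fun u hu => ?_
    rcases hu.2.eq_or_lt with rfl | h
    · simp [hχ1, Real.zero_rpow (show 1 - α ≠ 0 by linarith)]
    · have h1 : 0 < 1 - u := by linarith
      beta_reduce
      rw [dslope_of_ne _ h.ne, slope_def_field, hχ1, sub_eq_add_neg 1 α, Real.rpow_add h1,
        Real.rpow_one]
      have h2 : u - 1 ≠ 0 := by linarith
      field_simp
      ring
  -- The term with the differentiated weight is nonpositive and is discarded; this one-sided form of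
  -- the fundamental theorem asks integrability only of φ.
  have h := intervalIntegral.sub_le_integral_of_hasDeriv_right_of_le zero_le_one hcont
    (g' := fun u => α * (1 - u) ^ (-α - 1) * χ u + (1 - u) ^ (-α) * χ' u)
    (φ := fun u => (1 - u) ^ (-α) * χ' u) ?_ ?_ ?_
  · have h0 := hneg 0 (by simp)
    simp only [hχ1, mul_zero, sub_zero, Real.one_rpow, one_mul] at h
    linarith
  · intro u hu
    have h1 : 1 - u ≠ 0 := by linarith [hu.2]
    have h2 : HasDerivAt (fun u : ℝ => 1 - u) (-1) u := by
      simpa using (hasDerivAt_id u).const_sub 1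
    have h3 := (h2.rpow_const (p := -α) (Or.inl h1)).mul (hχ u ⟨hu.1.le, hu.2.le⟩)
    refine (h3.congr_deriv ?_).hasDerivWithinAt
    ring
  · exact (intervalIntegrable_iff_integrableOn_Icc_of_le zero_le_one).1
      (intervalIntegrable_one_sub_rpow_mul hα1 hχ')
  · intro u hu
    have h1 : 0 < 1 - u := by linarith [hu.2]
    have h2 := hneg u ⟨hu.1.le, hu.2.le⟩
    have h3 : α * (1 - u) ^ (-α - 1) * χ u ≤ 0 :=
      mul_nonpos_of_nonneg_of_nonpos (by positivity) h2
    linarith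

/-- The curve `u ↦ u z` stays in the disc. -/
theorem ofReal_mul_mem_ball {z : ℂ} (hz : ‖z‖ < 1) {u : ℝ} (hu : u ∈ Set.Icc (0 : ℝ) 1) :
    (u : ℂ) * z ∈ Metric.ball (0 : ℂ) 1 := by
  simp only [Metric.mem_ball, dist_zero_right, norm_mul, Complex.norm_real,
    Real.norm_of_nonneg hu.1]
  nlinarith [hu.2, norm_nonneg z]

theorem continuousOn_radial {g : ℂ → ℂ} (hg : ContinuousOn g (Metric.ball 0 1)) {z : ℂ}
    (hz : ‖z‖ < 1) : ContinuousOn (fun u : ℝ => g ((u : ℂ) * z)) (Set.Icc 0 1) :=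
  hg.comp (by fun_prop) fun _ hu => ofReal_mul_mem_ball hz hu

theorem hasDerivAt_radial {f : ℂ → ℂ} (hf : DifferentiableOn ℂ f (Metric.ball 0 1)) {z : ℂ}
    (hz : ‖z‖ < 1) {u : ℝ} (hu : u ∈ Set.Icc (0 : ℝ) 1) :
    HasDerivAt (fun u : ℝ => f ((u : ℂ) * z)) (deriv f ((u : ℂ) * z) * z) u := by
  have h1 : HasDerivAt f (deriv f ((u : ℂ) * z)) ((u : ℂ) * z) :=
    (hf.differentiableAt (Metric.isOpen_ball.mem_nhds (ofReal_mul_mem_ball hz hu))).hasDerivAt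
  have h2 : HasDerivAt (fun u : ℝ => (u : ℂ) * z) z u := by
    simpa using (Complex.ofRealCLM.hasDerivAt (x := u)).mul_const z
  exact h1.comp u h2

/-- The support inequality of a convex univalent function at a point of the disc. -/
theorem IsNormalizedConvexUnivalent.exists_support {f : ℂ → ℂ}
    (hf : IsNormalizedConvexUnivalent f) {z : ℂ} (hz0 : z ≠ 0) (hz : ‖z‖ < 1) :
    ∃ n : ℂ, n ≠ 0 ∧ ∀ u ∈ Set.Ico (0 : ℝ) 1,
      ‖z‖ * ‖n‖ / 2 * ((1 - u) / (1 + u)) ≤ ((f z - f ((u : ℂ) * z)) * n).re := by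
  set ρ := ‖z‖ with hρ
  have hρ0 : 0 < ρ := norm_pos_iff.2 hz0
  have hsub : Metric.ball (0 : ℂ) ρ ⊆ Metric.ball 0 1 := Metric.ball_subset_ball hz.le
  have hnot : f z ∉ f '' Metric.ball 0 ρ := by
    rintro ⟨w, hw, hfw⟩
    have := hf.injective (hsub hw) (by simpa using hz) hfw
    subst this
    simp [hρ] at hw
  obtain ⟨φ, hφ⟩ := geometric_hahn_banach_open_point (hf.convex_image_ball hz.le)
    (isOpen_image_of_isNormalizedConvexUnivalent hf hsub Metric.isOpen_ball) hnot
  -- Chosen so that the real functional φ becomes w ↦ Re (w n).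
  set n : ℂ := ⟨φ 1, -φ Complex.I⟩ with hn
  have hφn : ∀ w : ℂ, φ w = (w * n).re := by
    intro w
    have : w = w.re • (1 : ℂ) + w.im • Complex.I := by
      apply Complex.ext <;> simp
    conv_lhs => rw [this, map_add, map_smul, map_smul]
    simp [hn, Complex.mul_re]
  have hpos : ∀ w ∈ Metric.ball (0 : ℂ) ρ, 0 < ((f z - f w) * n).re := by
    intro w hw
    have := hφ (f w) ⟨w, hw, rfl⟩
    rw [hφn, hφn] at this
    rw [sub_mul, Complex.sub_re]
    linarith
  have h0D : (0 : ℂ) ∈ Metric.ball (0 : ℂ) ρ := by simpa using hρ0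
  have hd : DifferentiableOn ℂ (fun w => (f z - f w) * n) (Metric.ball 0 ρ) :=
    (((hf.holomorphic.mono hsub).const_sub _).mul_const _)
  -- As f'(0) = 1, the derivative bound reads ρ‖n‖ ≤ 2 Re h(0); Harnack at |w| = uρ supplies the
  -- factor (1-u)/(1+u).
  obtain ⟨h1, h2⟩ := harnack_of_re_pos hρ0 hd hpos
  have hder : deriv (fun w => (f z - f w) * n) 0 = -n := by
    have h3 : HasDerivAt f 1 0 := by
      rw [← hf.deriv_zero]
      exact (hf.holomorphic.differentiableAt (Metric.isOpen_ball.mem_nhds (by simp))).hasDerivAt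
    simpa using ((h3.const_sub (f z)).mul_const n).deriv
  rw [hder, norm_neg] at h1
  refine ⟨n, ?_, ?_⟩
  · intro h
    have := hpos 0 h0D
    simp [h] at this
  · intro u hu
    have hmem : (u : ℂ) * z ∈ Metric.ball (0 : ℂ) ρ := by
      simp only [Metric.mem_ball, dist_zero_right, norm_mul, Complex.norm_real,
        Real.norm_of_nonneg hu.1, ← hρ]
      nlinarith [hu.2]
    have h3 := h2 _ hmem
    rw [norm_mul, Complex.norm_real, Real.norm_of_nonneg hu.1, ← hρ] at h3
    have hu1 : 0 < 1 - u := by linarith [hu.2]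
    have hu2 : 0 < 1 + u := by linarith [hu.1]
    rw [← mul_div_assoc, div_le_iff₀ hu2]
    have h4 : (((f z - f 0) * n).re * (1 - u)) * ρ ≤
        (((f z - f ((u : ℂ) * z)) * n).re * (1 + u)) * ρ := by linarith
    have h5 := le_of_mul_le_mul_right h4 hρ0
    nlinarith

/-- The sharp lower bound for the weighted integral of the derivative along a radius. -/
theorem IsNormalizedConvexUnivalent.le_norm_integral {f : ℂ → ℂ}
    (hf : IsNormalizedConvexUnivalent f) {α : ℝ} (hα0 : 0 < α) (hα1 : α < 1) {z : ℂ}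
    (hz0 : z ≠ 0) (hz : ‖z‖ < 1) :
    ∫ u in (0 : ℝ)..1, (1 - u) ^ (-α) * ((1 + u) ^ 2)⁻¹ ≤
      ‖∫ u in (0 : ℝ)..1, (((1 - u) ^ (-α) : ℝ) : ℂ) * deriv f ((u : ℂ) * z)‖ := by
  obtain ⟨n, hn, hsupp⟩ := hf.exists_support hz0 hz
  have hf' : ContinuousOn (deriv f) (Metric.ball 0 1) :=
    (hf.holomorphic.deriv Metric.isOpen_ball).continuousOn
  set c : ℝ := ‖z‖ * ‖n‖ with hc
  have hc0 : 0 < c := mul_pos (norm_pos_iff.2 hz0) (norm_pos_iff.2 hn)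
  have hrad := continuousOn_radial hf' hz
  set K := ∫ u in (0 : ℝ)..1, (((1 - u) ^ (-α) : ℝ) : ℂ) * deriv f ((u : ℂ) * z) with hK
  have hcont1 : ContinuousOn (fun u : ℝ => (deriv f ((u : ℂ) * z) * z * n).re) (Set.Icc 0 1) :=
    Complex.continuous_re.comp_continuousOn ((hrad.mul continuousOn_const).mul continuousOn_const)
  have hcont2 : ContinuousOn (fun u : ℝ => ((1 + u) ^ 2)⁻¹) (Set.Icc 0 1) := by
    refine ContinuousOn.inv₀ (by fun_prop) fun u hu => ?_
    have := hu.1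
    positivity
  -- The support inequality says χ ≤ 0; since (1-u)/(1+u) has derivative -2/(1+u)², the factor c/2
  -- becomes c in χ'.
  have key := integral_one_sub_rpow_mul_deriv_nonneg hα0 hα1
    (χ := fun u => -((f z - f ((u : ℂ) * z)) * n).re + c / 2 * ((1 - u) / (1 + u)))
    (χ' := fun u => (deriv f ((u : ℂ) * z) * z * n).re - c * ((1 + u) ^ 2)⁻¹) ?_ ?_ ?_ ?_
  · have e1 : ∫ u in (0 : ℝ)..1, (1 - u) ^ (-α) * (deriv f ((u : ℂ) * z) * z * n).re =
        (K * (z * n)).re := by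
      have h1 := Complex.reCLM.intervalIntegral_comp_comm
        ((intervalIntegrable_one_sub_rpow_mul_complex hα1 hrad).mul_const (z * n))
      rw [intervalIntegral.integral_mul_const] at h1
      rw [← hK] at h1
      simp only [Complex.reCLM_apply] at h1
      rw [← h1]
      refine intervalIntegral.integral_congr fun u _ => ?_
      rw [mul_assoc, mul_assoc (_ : ℂ) (deriv f _), Complex.re_ofReal_mul]
    simp only [mul_sub] at key
    have hint : IntervalIntegrable (fun u : ℝ => (1 - u) ^ (-α) * (c * ((1 + u) ^ 2)⁻¹))
        MeasureTheory.volume 0 1 :=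
      intervalIntegrable_one_sub_rpow_mul hα1 (continuousOn_const.mul hcont2)
    rw [intervalIntegral.integral_sub (intervalIntegrable_one_sub_rpow_mul hα1 hcont1) hint, e1]
      at key
    have e2 : ∫ u in (0 : ℝ)..1, (1 - u) ^ (-α) * (c * ((1 + u) ^ 2)⁻¹) =
        c * ∫ u in (0 : ℝ)..1, (1 - u) ^ (-α) * ((1 + u) ^ 2)⁻¹ := by
      rw [← intervalIntegral.integral_const_mul]
      refine intervalIntegral.integral_congr fun u _ => ?_
      ring
    rw [e2] at key
    have h3 : (K * (z * n)).re ≤ c * ‖K‖ := by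
      refine (Complex.re_le_norm _).trans ?_
      rw [norm_mul, norm_mul, mul_comm]
    exact le_of_mul_le_mul_left (by linarith) hc0
  · intro u hu
    have h1 := (hasDerivAt_radial hf.holomorphic hz hu).const_sub (f z) |>.mul_const n
    have h2 := Complex.reCLM.hasFDerivAt.comp_hasDerivAt u h1
    have hu1 : 1 + u ≠ 0 := by linarith [hu.1]
    have h3 : HasDerivAt (fun u : ℝ => (1 - u) / (1 + u))
        ((-1 * (1 + u) - (1 - u) * 1) / (1 + u) ^ 2) u :=
      ((hasDerivAt_id u).const_sub 1).fun_div ((hasDerivAt_id u).const_add 1) hu1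
    have h4 := h2.neg.add (h3.const_mul (c / 2))
    refine h4.congr_deriv ?_
    simp only [Complex.reCLM_apply, neg_mul, Complex.neg_re]
    field_simp
    ring
  · exact hcont1.sub (continuousOn_const.mul hcont2)
  · simp
  · intro u hu
    rcases hu.2.eq_or_lt with rfl | h
    · simp
    · linarith [hsupp u ⟨hu.1, h⟩]

/-! ### The fractional derivative as a radial integral -/

/-- Differentiation of a weighted radial integral. -/
theorem hasDerivAt_integral_radial {f : ℂ → ℂ} (hf : DifferentiableOn ℂ f (Metric.ball 0 1))
    {α : ℝ} (hα1 : α < 1) {z : ℂ} (hz : ‖z‖ < 1) :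
    HasDerivAt (fun z : ℂ => ∫ u in (0 : ℝ)..1, (((1 - u) ^ (-α) : ℝ) : ℂ) * f ((u : ℂ) * z))
      (∫ u in (0 : ℝ)..1, (((1 - u) ^ (-α) : ℝ) : ℂ) * (deriv f ((u : ℂ) * z) * u)) z := by
  obtain ⟨R, hzR, hR1⟩ := exists_between hz
  have hf' : ContinuousOn (deriv f) (Metric.ball 0 1) :=
    (hf.deriv Metric.isOpen_ball).continuousOn
  obtain ⟨C, hC⟩ := (isCompact_closedBall (0 : ℂ) R).exists_bound_of_continuousOn
    (hf'.mono (Metric.closedBall_subset_ball hR1))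
  have hs : Metric.ball (0 : ℂ) R ∈ 𝓝 z := Metric.isOpen_ball.mem_nhds (by simpa using hzR)
  have hint : ∀ x ∈ Metric.ball (0 : ℂ) R, IntervalIntegrable
      (fun u : ℝ => (((1 - u) ^ (-α) : ℝ) : ℂ) * f ((u : ℂ) * x)) MeasureTheory.volume 0 1 := by
    intro x hx
    refine intervalIntegrable_one_sub_rpow_mul_complex hα1
      (continuousOn_radial hf.continuousOn ?_)
    exact lt_trans (by simpa using hx) hR1
  have hIoc : ∀ u : ℝ, u ∈ Set.uIoc (0 : ℝ) 1 → u ∈ Set.Icc (0 : ℝ) 1 := by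
    intro u hu
    rw [Set.uIoc_of_le zero_le_one] at hu
    exact ⟨hu.1.le, hu.2⟩
  refine (intervalIntegral.hasDerivAt_integral_of_dominated_loc_of_deriv_le
    (F := fun z u => (((1 - u) ^ (-α) : ℝ) : ℂ) * f ((u : ℂ) * z))
    (F' := fun z u => (((1 - u) ^ (-α) : ℝ) : ℂ) * (deriv f ((u : ℂ) * z) * u))
    (bound := fun u => (1 - u) ^ (-α) * C) hs ?_ (hint z (by simpa using hzR)) ?_ ?_ ?_ ?_).2
  · filter_upwards [hs] with x hx
    exact (intervalIntegrable_iff.1 (hint x hx)).aestronglyMeasurable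
  · have : ContinuousOn (fun u : ℝ => deriv f ((u : ℂ) * z) * u) (Set.Icc 0 1) :=
      (continuousOn_radial hf' hz).mul (by fun_prop)
    exact (intervalIntegrable_iff.1
      (intervalIntegrable_one_sub_rpow_mul_complex hα1 this)).aestronglyMeasurable
  · refine Eventually.of_forall fun u hu x hx => ?_
    have hu' := hIoc u hu
    have h1 : 0 ≤ 1 - u := by linarith [hu'.2]
    have hx' : ‖x‖ < R := by simpa using hx
    have h2 : ‖deriv f ((u : ℂ) * x)‖ ≤ C := by
      apply hC
      simp only [Metric.mem_closedBall, dist_zero_right, norm_mul, Complex.norm_real,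
        Real.norm_of_nonneg hu'.1]
      nlinarith [hu'.2, norm_nonneg x]
    rw [norm_mul, norm_mul, Complex.norm_real, Complex.norm_real, Real.norm_of_nonneg hu'.1,
      Real.norm_of_nonneg (Real.rpow_nonneg h1 _)]
    gcongr
    exact (mul_le_of_le_one_right (norm_nonneg _) hu'.2).trans h2
  · exact intervalIntegrable_one_sub_rpow_mul hα1 continuousOn_const
  · refine Eventually.of_forall fun u hu x hx => ?_
    have hx1 : ‖x‖ < 1 := lt_trans (by simpa using hx) hR1
    have h1 : HasDerivAt f (deriv f ((u : ℂ) * x)) ((u : ℂ) * x) :=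
      (hf.differentiableAt (Metric.isOpen_ball.mem_nhds
        (ofReal_mul_mem_ball hx1 (hIoc u hu)))).hasDerivAt
    have h2 : HasDerivAt (fun x : ℂ => (u : ℂ) * x) u x := by
      simpa using (hasDerivAt_id x).const_mul (u : ℂ)
    exact (h1.comp x h2).const_mul _

/-- Integration by parts along a radius. -/
theorem integral_radial_by_parts {f : ℂ → ℂ} (hf : DifferentiableOn ℂ f (Metric.ball 0 1))
    (hf0 : f 0 = 0) {α : ℝ} (hα1 : α < 1) {z : ℂ} (hz : ‖z‖ < 1) :
    (1 - α : ℂ) * (∫ u in (0 : ℝ)..1, (((1 - u) ^ (-α) : ℝ) : ℂ) * f ((u : ℂ) * z)) +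
      z * (∫ u in (0 : ℝ)..1, (((1 - u) ^ (-α) : ℝ) : ℂ) * (deriv f ((u : ℂ) * z) * u)) =
      z * ∫ u in (0 : ℝ)..1, (((1 - u) ^ (-α) : ℝ) : ℂ) * deriv f ((u : ℂ) * z) := by
  have hf' : ContinuousOn (deriv f) (Metric.ball 0 1) :=
    (hf.deriv Metric.isOpen_ball).continuousOn
  have hrad' := continuousOn_radial hf' hz
  have hrad := continuousOn_radial hf.continuousOn hz
  have hu' : ContinuousOn (fun u : ℝ => deriv f ((u : ℂ) * z) * u) (Set.Icc 0 1) :=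
    hrad'.mul (by fun_prop)
  have i1 := intervalIntegrable_one_sub_rpow_mul_complex hα1 hrad
  have i2 := intervalIntegrable_one_sub_rpow_mul_complex hα1 hu'
  have i3 := intervalIntegrable_one_sub_rpow_mul_complex hα1 hrad'
  have i4 := ((i1.const_mul (1 - α : ℂ)).add (i2.const_mul z)).sub (i3.const_mul z)
  have hcont : ContinuousOn (fun u : ℝ => -((((1 - u) ^ (1 - α) : ℝ) : ℂ) * f ((u : ℂ) * z)))
      (Set.Icc 0 1) := by
    refine (ContinuousOn.mul ?_ hrad).neg
    refine Complex.continuous_ofReal.comp_continuousOn ?_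
    exact ContinuousOn.rpow_const (by fun_prop) fun u _ => Or.inr (by linarith)
  -- The antiderivative -(1-u)^(1-α) f(uz) vanishes at u = 1 through its power and at u = 0 because
  -- f(0) = 0.
  have key := intervalIntegral.integral_eq_sub_of_hasDerivAt_of_le zero_le_one hcont ?_ i4
  · rw [intervalIntegral.integral_sub ((i1.const_mul _).add (i2.const_mul z)) (i3.const_mul z),
      intervalIntegral.integral_add (i1.const_mul _) (i2.const_mul z),
      intervalIntegral.integral_const_mul, intervalIntegral.integral_const_mul,
      intervalIntegral.integral_const_mul] at key
    simp only [sub_self, Real.zero_rpow (show 1 - α ≠ 0 by linarith), Complex.ofReal_zero,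
      zero_mul, hf0, mul_zero, neg_zero] at key
    exact sub_eq_zero.1 key
  · intro u hu
    have h0 : 0 < 1 - u := by linarith [hu.2]
    have h1 := hasDerivAt_radial hf hz ⟨hu.1.le, hu.2.le⟩
    have h2 : HasDerivAt (fun u : ℝ => 1 - u) (-1) u := by
      simpa using (hasDerivAt_id u).const_sub 1
    have h3 := (h2.rpow_const (p := 1 - α) (Or.inl h0.ne')).ofReal_comp
    refine (h3.mul h1).neg.congr_deriv ?_
    have e1 : 1 - α - 1 = -α := by ring
    have e2 : (1 - u) ^ (1 - α) = (1 - u) ^ (-α) * (1 - u) := by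
      rw [← Real.rpow_add_one h0.ne']; congr 1; ring
    rw [e1, e2]
    push_cast
    ring

theorem norm_exp_lt_one {ζ : ℂ} (hζ : ζ ∈ logDisc) : ‖Complex.exp ζ‖ < 1 := by
  rw [Complex.norm_exp]; exact Real.exp_lt_one_iff.2 hζ

theorem isOpen_logDisc : IsOpen logDisc := isOpen_lt Complex.continuous_re continuous_const

/-- All multivaluedness is collected in the exponential factor; the remaining integral depends only
on z = exp ζ. -/
theorem rlPrimitive_eq (α : ℝ) (f : ℂ → ℂ) (ζ : ℂ) :
    rlPrimitive α f ζ = Complex.exp ((1 - α) * ζ) *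
      ∫ u in (0 : ℝ)..1, (((1 - u) ^ (-α) : ℝ) : ℂ) * f ((u : ℂ) * Complex.exp ζ) := by
  rw [rlPrimitive, ← intervalIntegral.integral_const_mul]
  refine intervalIntegral.integral_congr fun u _ => ?_
  have : Complex.exp ((1 - α) * ζ) = Complex.exp (-(α : ℂ) * ζ) * Complex.exp ζ := by
    rw [← Complex.exp_add]; congr 1; ring
  rw [this]; ring

theorem hasDerivAt_rlPrimitive {f : ℂ → ℂ} (hf : DifferentiableOn ℂ f (Metric.ball 0 1))
    (hf0 : f 0 = 0) {α : ℝ} (hα1 : α < 1) {ζ : ℂ} (hζ : ζ ∈ logDisc) :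
    HasDerivAt (rlPrimitive α f) (Complex.exp ((1 - α) * ζ) * (Complex.exp ζ *
      ∫ u in (0 : ℝ)..1, (((1 - u) ^ (-α) : ℝ) : ℂ) * deriv f ((u : ℂ) * Complex.exp ζ))) ζ := by
  have hz := norm_exp_lt_one hζ
  have h1 := (hasDerivAt_integral_radial hf hα1 hz).comp ζ (Complex.hasDerivAt_exp ζ)
  have h2 : HasDerivAt (fun ζ : ℂ => Complex.exp ((1 - α) * ζ))
      (Complex.exp ((1 - α) * ζ) * (1 - α)) ζ := by
    simpa using ((hasDerivAt_id ζ).const_mul (1 - α : ℂ)).cexp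
  have h3 := h2.mul h1
  rw [funext (rlPrimitive_eq α f)]
  refine h3.congr_deriv ?_
  rw [← integral_radial_by_parts hf hf0 hα1 hz]
  simp only [Function.comp_apply]
  ring

/-- The fractional derivative as a weighted radial integral of `f'`. -/
theorem fracDeriv_eq {f : ℂ → ℂ} (hf : DifferentiableOn ℂ f (Metric.ball 0 1))
    (hf0 : f 0 = 0) {α : ℝ} (hα1 : α < 1) {ζ : ℂ} (hζ : ζ ∈ logDisc) :
    fracDeriv α f ζ = ((Real.Gamma (1 - α) : ℝ) : ℂ)⁻¹ * (Complex.exp ((1 - α) * ζ) *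
      ∫ u in (0 : ℝ)..1, (((1 - u) ^ (-α) : ℝ) : ℂ) * deriv f ((u : ℂ) * Complex.exp ζ)) := by
  rw [fracDeriv, (hasDerivAt_rlPrimitive hf hf0 hα1 hζ).deriv]
  have : Complex.exp (-ζ) * Complex.exp ζ = 1 := by rw [← Complex.exp_add]; simp
  linear_combination ((Real.Gamma (1 - α) : ℝ) : ℂ)⁻¹ * (Complex.exp ((1 - α) * ζ) *
      ∫ u in (0 : ℝ)..1, (((1 - u) ^ (-α) : ℝ) : ℂ) * deriv f ((u : ℂ) * Complex.exp ζ)) * this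

theorem norm_fracDeriv {f : ℂ → ℂ} (hf : DifferentiableOn ℂ f (Metric.ball 0 1))
    (hf0 : f 0 = 0) {α : ℝ} (hα1 : α < 1) {ζ : ℂ} (hζ : ζ ∈ logDisc) :
    ‖fracDeriv α f ζ‖ = (Real.Gamma (1 - α))⁻¹ * (Real.exp ((1 - α) * ζ.re) *
      ‖∫ u in (0 : ℝ)..1, (((1 - u) ^ (-α) : ℝ) : ℂ) * deriv f ((u : ℂ) * Complex.exp ζ)‖) := by
  have hΓ : 0 < Real.Gamma (1 - α) := Real.Gamma_pos_of_pos (by linarith)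
  rw [fracDeriv_eq hf hf0 hα1 hζ, norm_mul, norm_mul, norm_inv, Complex.norm_real,
    Real.norm_of_nonneg hΓ.le, Complex.norm_exp]
  congr 3
  have : (1 - α : ℂ) = ((1 - α : ℝ) : ℂ) := by push_cast; rfl
  rw [this, Complex.re_ofReal_mul]

theorem differentiableOn_fracDeriv {f : ℂ → ℂ} (hf : DifferentiableOn ℂ f (Metric.ball 0 1))
    (hf0 : f 0 = 0) {α : ℝ} (hα1 : α < 1) : DifferentiableOn ℂ (fracDeriv α f) logDisc := by
  have h1 : DifferentiableOn ℂ (rlPrimitive α f) logDisc := fun ζ hζ =>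
    (hasDerivAt_rlPrimitive hf hf0 hα1 hζ).differentiableAt.differentiableWithinAt
  have h2 := h1.deriv isOpen_logDisc
  exact ((by fun_prop : DifferentiableOn ℂ (fun ζ : ℂ => Complex.exp (-ζ)) logDisc).mul
    h2).const_mul _

/-- Passing to another logarithm multiplies the fractional derivative by a unimodular constant. -/
theorem fracDeriv_add_two_pi {f : ℂ → ℂ} (hf : DifferentiableOn ℂ f (Metric.ball 0 1))
    (hf0 : f 0 = 0) {α : ℝ} (hα1 : α < 1) {ζ : ℂ} (hζ : ζ ∈ logDisc) (k : ℤ) :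
    fracDeriv α f (ζ + k * (2 * Real.pi * Complex.I)) =
      Complex.exp (((1 - α) * (k * (2 * Real.pi)) : ℝ) * Complex.I) * fracDeriv α f ζ := by
  have hζ' : ζ + k * (2 * Real.pi * Complex.I) ∈ logDisc := by
    simpa [logDisc] using hζ
  have he : Complex.exp (ζ + k * (2 * Real.pi * Complex.I)) = Complex.exp ζ := by
    rw [Complex.exp_add, Complex.exp_int_mul_two_pi_mul_I, mul_one]
  rw [fracDeriv_eq hf hf0 hα1 hζ, fracDeriv_eq hf hf0 hα1 hζ', he, mul_add, Complex.exp_add]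
  have : (1 - α : ℂ) * (k * (2 * Real.pi * Complex.I)) =
      (((1 - α) * (k * (2 * Real.pi)) : ℝ) : ℂ) * Complex.I := by push_cast; ring
  rw [this]; ring

/-- The fractional derivative is dominated by `|z|^(1-α)` near the centre. -/
theorem exists_norm_fracDeriv_le {f : ℂ → ℂ} (hf : DifferentiableOn ℂ f (Metric.ball 0 1))
    (hf0 : f 0 = 0) {α : ℝ} (hα1 : α < 1) {c : ℝ} (hc : c < 0) :
    ∃ C : ℝ, ∀ ζ : ℂ, ζ.re ≤ c → ‖fracDeriv α f ζ‖ ≤ C * Real.exp ((1 - α) * ζ.re) := by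
  have hf' : ContinuousOn (deriv f) (Metric.ball 0 1) :=
    (hf.deriv Metric.isOpen_ball).continuousOn
  have hR1 : Real.exp c < 1 := Real.exp_lt_one_iff.2 hc
  obtain ⟨C, hC⟩ := (isCompact_closedBall (0 : ℂ) (Real.exp c)).exists_bound_of_continuousOn
    (hf'.mono (Metric.closedBall_subset_ball hR1))
  have hΓ : 0 < Real.Gamma (1 - α) := Real.Gamma_pos_of_pos (by linarith)
  refine ⟨(Real.Gamma (1 - α))⁻¹ * ∫ u in (0 : ℝ)..1, (1 - u) ^ (-α) * C, fun ζ hζ => ?_⟩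
  rw [norm_fracDeriv hf hf0 hα1 (show ζ ∈ logDisc from hζ.trans_lt hc), mul_assoc,
    mul_comm (Real.exp _)]
  gcongr
  refine intervalIntegral.norm_integral_le_of_norm_le zero_le_one ?_
    (intervalIntegrable_one_sub_rpow_mul hα1 continuousOn_const)
  refine Eventually.of_forall fun u hu => ?_
  have h1 : 0 ≤ 1 - u := by linarith [hu.2]
  rw [norm_mul, Complex.norm_real, Real.norm_of_nonneg (Real.rpow_nonneg h1 _)]
  gcongr
  apply hC
  simp only [Metric.mem_closedBall, dist_zero_right, norm_mul, Complex.norm_real,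
    Real.norm_of_nonneg hu.1.le, Complex.norm_exp]
  have : Real.exp ζ.re ≤ Real.exp c := Real.exp_le_exp.2 hζ
  nlinarith [hu.2, Real.exp_pos ζ.re]

/-! ### Euler's integral and the hypergeometric function -/

/-- Euler's integral for the fractional derivative of `z / (1 - z)`. -/
noncomputable def eulerIntegral (α x : ℝ) : ℝ :=
  ∫ u in (0 : ℝ)..1, (1 - u) ^ (-α) * ((1 - x * u) ^ 2)⁻¹

/-- The Beta integral B(n+1, 1-α), brought from ℂ back to ℝ. -/
theorem integral_one_sub_rpow_mul_pow {α : ℝ} (hα1 : α < 1) (n : ℕ) :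
    ∫ u in (0 : ℝ)..1, (1 - u) ^ (-α) * u ^ n =
      Real.Gamma ((n : ℝ) + 1) * Real.Gamma (1 - α) / Real.Gamma ((n : ℝ) + 2 - α) := by
  have h := Complex.betaIntegral_eq_Gamma_mul_div ((n : ℂ) + 1) ((1 - α : ℝ) : ℂ)
    (by simp; positivity) (by simp; linarith)
  have e1 : Complex.betaIntegral ((n : ℂ) + 1) ((1 - α : ℝ) : ℂ) =
      ((∫ u in (0 : ℝ)..1, (1 - u) ^ (-α) * u ^ n : ℝ) : ℂ) := by
    rw [Complex.betaIntegral, ← intervalIntegral.integral_ofReal]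
    refine intervalIntegral.integral_congr fun u hu => ?_
    rw [Set.uIcc_of_le zero_le_one] at hu
    have h1 : 0 ≤ 1 - u := by linarith [hu.2]
    rw [add_sub_cancel_right, Complex.cpow_natCast, Complex.ofReal_mul, Complex.ofReal_cpow h1,
      mul_comm]
    push_cast
    congr 2
    ring
  have e2 : ((n : ℂ) + 1) = (((n : ℝ) + 1 : ℝ) : ℂ) := by push_cast; rfl
  rw [e1, e2, ← Complex.ofReal_add, Complex.Gamma_ofReal, Complex.Gamma_ofReal,
    Complex.Gamma_ofReal] at h
  have h' : ((∫ u in (0 : ℝ)..1, (1 - u) ^ (-α) * u ^ n : ℝ) : ℂ) =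
      ((Real.Gamma ((n : ℝ) + 1) * Real.Gamma (1 - α) / Real.Gamma ((n : ℝ) + 1 + (1 - α)) : ℝ)
        : ℂ) := by
    rw [h]; push_cast; rfl
  rw [Complex.ofReal_inj.1 h']
  congr 2
  ring

theorem hasSum_succ_mul_geometric {y : ℝ} (hy : |y| < 1) :
    HasSum (fun n : ℕ => ((n : ℝ) + 1) * y ^ n) ((1 - y) ^ 2)⁻¹ := by
  have h := hasSum_choose_mul_geometric_of_norm_lt_one 1 (r := y) (by simpa using hy)
  simpa using h

/-- Euler's integral representation, termwise. -/
theorem hasSum_eulerIntegral {α : ℝ} (hα1 : α < 1) {x : ℝ} (hx : |x| < 1) :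
    HasSum (fun n : ℕ => Real.Gamma ((n : ℝ) + 2) / Real.Gamma ((n : ℝ) + 2 - α) * x ^ n)
      ((Real.Gamma (1 - α))⁻¹ * eulerIntegral α x) := by
  have hΓ : 0 < Real.Gamma (1 - α) := Real.Gamma_pos_of_pos (by linarith)
  have habs : |(|x|)| < 1 := by rwa [abs_abs]
  have hS := hasSum_succ_mul_geometric habs
  have hIoc : ∀ u : ℝ, u ∈ Set.uIoc (0 : ℝ) 1 → 0 < u ∧ u ≤ 1 := by
    intro u hu
    rwa [Set.uIoc_of_le zero_le_one] at hu
  have key := intervalIntegral.hasSum_integral_of_dominated_convergence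
    (μ := MeasureTheory.volume) (a := 0) (b := 1)
    (F := fun (n : ℕ) (u : ℝ) => (1 - u) ^ (-α) * (((n : ℝ) + 1) * (x * u) ^ n))
    (f := fun u => (1 - u) ^ (-α) * ((1 - x * u) ^ 2)⁻¹)
    (fun n u => (1 - u) ^ (-α) * (((n : ℝ) + 1) * |x| ^ n)) ?_ ?_ ?_ ?_ ?_
  · refine (key.mul_left (Real.Gamma (1 - α))⁻¹).congr_fun fun n => ?_
    have e : ∫ u in (0 : ℝ)..1, (1 - u) ^ (-α) * (((n : ℝ) + 1) * (x * u) ^ n) =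
        (((n : ℝ) + 1) * x ^ n) * ∫ u in (0 : ℝ)..1, (1 - u) ^ (-α) * u ^ n := by
      rw [← intervalIntegral.integral_const_mul]
      refine intervalIntegral.integral_congr fun u _ => ?_
      rw [mul_pow]; ring
    have hg : Real.Gamma ((n : ℝ) + 2) = ((n : ℝ) + 1) * Real.Gamma ((n : ℝ) + 1) := by
      rw [← Real.Gamma_add_one (by positivity)]; congr 1; ring
    rw [e, integral_one_sub_rpow_mul_pow hα1, hg]
    field_simp
  · intro n
    exact (intervalIntegrable_iff.1 (intervalIntegrable_one_sub_rpow_mul hα1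
      (by fun_prop))).aestronglyMeasurable
  · intro n
    refine Eventually.of_forall fun u hu => ?_
    obtain ⟨h0, h1⟩ := hIoc u hu
    have h2 : 0 ≤ 1 - u := by linarith
    rw [norm_mul, Real.norm_of_nonneg (Real.rpow_nonneg h2 _), norm_mul, norm_pow, norm_mul,
      Real.norm_of_nonneg (by positivity : (0 : ℝ) ≤ (n : ℝ) + 1), Real.norm_of_nonneg h0.le,
      Real.norm_eq_abs]
    have : |x| * u ≤ |x| := mul_le_of_le_one_right (abs_nonneg x) h1
    gcongr
  · exact Eventually.of_forall fun u _ => hS.summable.mul_left _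
  · simp only [tsum_mul_left]
    exact intervalIntegrable_one_sub_rpow_mul hα1 continuousOn_const
  · refine Eventually.of_forall fun u hu => ?_
    obtain ⟨h0, h1⟩ := hIoc u hu
    refine (hasSum_succ_mul_geometric ?_).mul_left _
    rw [abs_mul, abs_of_pos h0]
    exact (mul_le_of_le_one_right (abs_nonneg x) h1).trans_lt hx

theorem Gamma_mul_ascPochhammer {x : ℝ} (hx : 0 < x) (n : ℕ) :
    Real.Gamma x * (ascPochhammer ℝ n).eval x = Real.Gamma ((n : ℝ) + x) := by
  induction n with
  | zero => simp
  | succ n ih =>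
    rw [ascPochhammer_succ_eval, ← mul_assoc, ih]
    have : ((n + 1 : ℕ) : ℝ) + x = ((n : ℝ) + x) + 1 := by push_cast; ring
    rw [this, Real.Gamma_add_one (by positivity)]
    ring

/-- The series agree termwise: (1)_n cancels n!, and Γ(x) (x)_n = Γ(n+x) handles the other two
symbols. -/
theorem ordinaryHypergeometric_eq_eulerIntegral {α : ℝ} (hα1 : α < 1) {x : ℝ} (hx : |x| < 1) :
    ordinaryHypergeometric (1 : ℝ) 2 (2 - α) x =
      Real.Gamma (2 - α) * ((Real.Gamma (1 - α))⁻¹ * eulerIntegral α x) := by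
  rw [ordinaryHypergeometric_eq_tsum, ← ((hasSum_eulerIntegral hα1 hx).mul_left
    (Real.Gamma (2 - α))).tsum_eq]
  refine tsum_congr fun n => ?_
  have h2α : 0 < 2 - α := by linarith
  have hΓ : 0 < Real.Gamma (2 - α) := Real.Gamma_pos_of_pos h2α
  have h1 := Gamma_mul_ascPochhammer (x := 2 - α) h2α n
  have h2 := Gamma_mul_ascPochhammer (x := 2) two_pos n
  rw [Real.Gamma_two, one_mul] at h2
  have h3 : (n : ℝ) + 2 - α = (n : ℝ) + (2 - α) := by ring
  have h4 : 0 < Real.Gamma ((n : ℝ) + (2 - α)) := Real.Gamma_pos_of_pos (by positivity)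
  have h5 : (ascPochhammer ℝ n).eval (2 - α) ≠ 0 := by
    intro h
    rw [h, mul_zero] at h1
    exact h4.ne h1
  have h6 : (n.factorial : ℝ) ≠ 0 := by positivity
  rw [ascPochhammer_eval_one, h2, h3, ← h1, smul_eq_mul]
  field_simp

theorem one_sub_mul_pos {x u : ℝ} (hx : x < 1) (hu0 : 0 ≤ u) (hu1 : u ≤ 1) : 0 < 1 - x * u := by
  rcases le_total x 0 with h | h
  · linarith [mul_nonpos_of_nonpos_of_nonneg h hu0]
  · linarith [mul_le_of_le_one_right h hu1]

theorem continuousOn_eulerIntegrand {x : ℝ} (hx : x < 1) :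
    ContinuousOn (fun u : ℝ => ((1 - x * u) ^ 2)⁻¹) (Set.Icc 0 1) := by
  refine ContinuousOn.inv₀ (by fun_prop) fun u hu => ?_
  have : 0 < 1 - x * u := one_sub_mul_pos hx hu.1 hu.2
  positivity

/-- Needed in particular at x = -1, where the termwise expansion above does not apply. -/
theorem continuousAt_eulerIntegral {α : ℝ} (hα1 : α < 1) {x : ℝ} (hx : x < 1) :
    ContinuousAt (eulerIntegral α) x := by
  obtain ⟨m, hxm, hm1⟩ := exists_between (max_lt hx zero_lt_one)
  have hm0 : 0 < m := (le_max_right _ _).trans_lt hxm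
  have hev : ∀ᶠ y in 𝓝 x, y < m := Iio_mem_nhds ((le_max_left _ _).trans_lt hxm)
  refine intervalIntegral.continuousAt_of_dominated_interval
    (bound := fun u => (1 - u) ^ (-α) * ((1 - m) ^ 2)⁻¹) ?_ ?_
    (intervalIntegrable_one_sub_rpow_mul hα1 continuousOn_const) ?_
  · filter_upwards [hev] with y hy
    exact (intervalIntegrable_iff.1 (intervalIntegrable_one_sub_rpow_mul hα1
      (continuousOn_eulerIntegrand (hy.trans hm1)))).aestronglyMeasurable
  · filter_upwards [hev] with y hy
    refine Eventually.of_forall fun u hu => ?_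
    rw [Set.uIoc_of_le zero_le_one] at hu
    have h1 : 0 ≤ 1 - u := by linarith [hu.2]
    have h2 : 1 - m ≤ 1 - y * u := by nlinarith [hu.1, hu.2]
    have h3 : 0 < 1 - m := by linarith
    rw [norm_mul, Real.norm_of_nonneg (Real.rpow_nonneg h1 _),
      Real.norm_of_nonneg (by positivity)]
    gcongr
  · refine Eventually.of_forall fun u hu => ?_
    rw [Set.uIoc_of_le zero_le_one] at hu
    have : 0 < 1 - x * u := one_sub_mul_pos hx hu.1.le hu.2
    refine ContinuousAt.mul continuousAt_const (ContinuousAt.inv₀ (by fun_prop) ?_)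
    positivity

theorem eulerIntegral_mono {α : ℝ} (hα1 : α < 1) {x y : ℝ} (hxy : x ≤ y) (hy : y < 1) :
    eulerIntegral α x ≤ eulerIntegral α y := by
  refine intervalIntegral.integral_mono_on zero_le_one
    (intervalIntegrable_one_sub_rpow_mul hα1 (continuousOn_eulerIntegrand (hxy.trans_lt hy)))
    (intervalIntegrable_one_sub_rpow_mul hα1 (continuousOn_eulerIntegrand hy)) fun u hu => ?_
  have h1 : 0 ≤ 1 - u := by linarith [hu.2]
  have h2 : 0 < 1 - y * u := one_sub_mul_pos hy hu.1 hu.2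
  have h3 : x * u ≤ y * u := mul_le_mul_of_nonneg_right hxy hu.1
  gcongr

theorem eulerIntegral_pos {α : ℝ} (hα1 : α < 1) {x : ℝ} (hx : x < 1) :
    0 < eulerIntegral α x := by
  refine intervalIntegral.intervalIntegral_pos_of_pos_on
    (intervalIntegrable_one_sub_rpow_mul hα1 (continuousOn_eulerIntegrand hx)) (fun u hu => ?_)
    one_pos
  have h1 : 0 < 1 - u := by linarith [hu.2]
  have h2 : 0 < 1 - x * u := one_sub_mul_pos hx hu.1.le hu.2.le
  positivity

/-- This strict inequality is what puts the radius P below 1. -/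
theorem eulerIntegral_neg_one_lt {α : ℝ} (hα1 : α < 1) :
    eulerIntegral α (-1) < eulerIntegral α 0 := by
  have i0 := intervalIntegrable_one_sub_rpow_mul hα1
    (continuousOn_eulerIntegrand (x := 0) one_pos)
  have i1 := intervalIntegrable_one_sub_rpow_mul hα1
    (continuousOn_eulerIntegrand (x := -1) (by norm_num))
  rw [← sub_pos, eulerIntegral, eulerIntegral, ← intervalIntegral.integral_sub i0 i1]
  refine intervalIntegral.intervalIntegral_pos_of_pos_on (i0.sub i1) (fun u hu => ?_) one_pos
  have h1 : 0 < 1 - u := by linarith [hu.2]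
  have h2 : ((1 - -1 * u) ^ 2)⁻¹ < 1 := by
    apply inv_lt_one_of_one_lt₀
    nlinarith [hu.1]
  have h3 : 0 < (1 - u) ^ (-α) := Real.rpow_pos_of_pos h1 _
  simp only [zero_mul, sub_zero, one_pow, inv_one, mul_one]
  nlinarith

/-! ### The constant L(α) and the radius equation -/

/-- The limiting value of the fractional derivative of `z / (1 - z)` at `-1`, in modulus. -/
noncomputable def fracRadiusValue (α : ℝ) : ℝ :=
  (Real.Gamma (1 - α))⁻¹ * eulerIntegral α (-1)

theorem fracRadiusValue_pos {α : ℝ} (hα1 : α < 1) : 0 < fracRadiusValue α :=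
  mul_pos (inv_pos.2 (Real.Gamma_pos_of_pos (by linarith)))
    (eulerIntegral_pos hα1 (by norm_num))

theorem tendsto_fracRadiusValue {α : ℝ} (hα1 : α < 1) :
    Tendsto (fun t : ℝ => |t ^ (1 - α) / Real.Gamma (2 - α) *
        ordinaryHypergeometric (1 : ℝ) 2 (2 - α) (-t)|) (𝓝[<] 1) (𝓝 (fracRadiusValue α)) := by
  have hΓ2 : Real.Gamma (2 - α) ≠ 0 := (Real.Gamma_pos_of_pos (by linarith)).ne'
  have hc : ContinuousAt (fun t : ℝ => |t ^ (1 - α) * ((Real.Gamma (1 - α))⁻¹ *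
      eulerIntegral α (-t))|) 1 := by
    refine (ContinuousAt.mul ?_ (continuousAt_const.mul ?_)).abs
    · exact Real.continuousAt_rpow_const _ _ (Or.inl one_ne_zero)
    · exact (continuousAt_eulerIntegral hα1 (by norm_num)).comp continuousAt_neg
  have h := hc.tendsto.mono_left (nhdsWithin_le_nhds (s := Set.Iio 1))
  rw [Real.one_rpow, one_mul, ← fracRadiusValue, abs_of_pos (fracRadiusValue_pos hα1)] at h
  refine h.congr' ?_
  filter_upwards [Ioo_mem_nhdsLT (zero_lt_one' ℝ)] with t ht
  rw [ordinaryHypergeometric_eq_eulerIntegral hα1 (by rw [abs_neg, abs_of_pos ht.1]; exact ht.2)]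
  congr 1
  field_simp

theorem hasSum_fracTerm {α : ℝ} (hα1 : α < 1) {r : ℝ} (hr0 : 0 ≤ r) (hr1 : r < 1) :
    HasSum (fun n : ℕ => fracTerm α r (n + 1))
      (r ^ (1 - α) * ((Real.Gamma (1 - α))⁻¹ * eulerIntegral α r)) := by
  refine ((hasSum_eulerIntegral hα1 (by rwa [abs_of_nonneg hr0])).mul_left
    (r ^ (1 - α))).congr_fun ?_
  intro n
  have e1 : ((n + 1 : ℕ) : ℝ) + 1 = (n : ℝ) + 2 := by push_cast; ring
  have e2 : r ^ (((n + 1 : ℕ) : ℝ) - α) = r ^ (1 - α) * r ^ n := by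
    -- At r = 0 both sides vanish, since the exponents n + 1 - α and 1 - α are nonzero.
    rcases hr0.eq_or_lt with rfl | h
    · have h1 : ((n + 1 : ℕ) : ℝ) - α ≠ 0 := by push_cast; linarith [n.cast_nonneg (α := ℝ)]
      rw [Real.zero_rpow h1, Real.zero_rpow (by linarith), zero_mul]
    · rw [← Real.rpow_natCast, ← Real.rpow_add h]
      congr 1
      push_cast; ring
  rw [fracTerm, e1, e2]
  ring

/-- The smallest positive solution of the radius equation. -/
theorem exists_radius {α : ℝ} (hα1 : α < 1) :
    ∃ P : ℝ, P < 1 ∧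
      IsLeast {r : ℝ | 0 < r ∧ HasSum (fun n : ℕ => fracTerm α r (n + 1)) (fracRadiusValue α)} P ∧
      ∀ r : ℝ, 0 ≤ r → r ≤ P →
        r ^ (1 - α) * ((Real.Gamma (1 - α))⁻¹ * eulerIntegral α r) ≤ fracRadiusValue α := by
  set S : ℝ → ℝ := fun r => r ^ (1 - α) * ((Real.Gamma (1 - α))⁻¹ * eulerIntegral α r) with hS
  have h1α : 0 < 1 - α := by linarith
  have hΓ : 0 < (Real.Gamma (1 - α))⁻¹ := inv_pos.2 (Real.Gamma_pos_of_pos h1α)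
  have hmono : ∀ x y : ℝ, 0 ≤ x → x < y → y < 1 → S x < S y := by
    intro x y hx hxy hy
    have h1 := eulerIntegral_mono hα1 hxy.le hy
    have h2 := eulerIntegral_pos hα1 (hxy.trans hy)
    have h3 : x ^ (1 - α) < y ^ (1 - α) := Real.rpow_lt_rpow hx hxy h1α
    have h4 : 0 < (Real.Gamma (1 - α))⁻¹ * eulerIntegral α x := by positivity
    calc S x < y ^ (1 - α) * ((Real.Gamma (1 - α))⁻¹ * eulerIntegral α x) :=
          mul_lt_mul_of_pos_right h3 h4
      _ ≤ S y := by
          have : 0 ≤ y ^ (1 - α) := Real.rpow_nonneg (hx.trans hxy.le) _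
          simp only [hS]
          gcongr
  -- Replacing Euler's integral at r by its smaller value at 0 already gives a lower bound for S
  -- exceeding L near r = 1; no blow-up of S is needed.
  obtain ⟨b, hb0, hb1, hb⟩ : ∃ b : ℝ, 0 < b ∧ b < 1 ∧ fracRadiusValue α ≤ S b := by
    have ht : Tendsto (fun r : ℝ => r ^ (1 - α) * ((Real.Gamma (1 - α))⁻¹ * eulerIntegral α 0))
        (𝓝[<] 1) (𝓝 ((1 : ℝ) ^ (1 - α) * ((Real.Gamma (1 - α))⁻¹ * eulerIntegral α 0))) :=
      ((Real.continuousAt_rpow_const _ _ (Or.inl one_ne_zero)).mul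
        continuousAt_const).tendsto.mono_left nhdsWithin_le_nhds
    have hlt : fracRadiusValue α <
        (1 : ℝ) ^ (1 - α) * ((Real.Gamma (1 - α))⁻¹ * eulerIntegral α 0) := by
      rw [Real.one_rpow, one_mul]
      exact mul_lt_mul_of_pos_left (eulerIntegral_neg_one_lt hα1) hΓ
    obtain ⟨b, h1, h2⟩ := ((ht.eventually_const_lt hlt).and
      (Ioo_mem_nhdsLT (zero_lt_one' ℝ))).exists
    refine ⟨b, h2.1, h2.2, h1.le.trans ?_⟩
    have h3 := eulerIntegral_mono hα1 h2.1.le h2.2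
    have h4 : 0 ≤ b ^ (1 - α) := Real.rpow_nonneg h2.1.le _
    simp only [hS]
    gcongr
  have hcont : ContinuousOn S (Set.Icc 0 b) := by
    intro x hx
    refine ContinuousAt.continuousWithinAt (ContinuousAt.mul ?_ (continuousAt_const.mul ?_))
    · exact Real.continuousAt_rpow_const _ _ (Or.inr h1α.le)
    · exact continuousAt_eulerIntegral hα1 (hx.2.trans_lt hb1)
  have hS0 : S 0 = 0 := by simp [hS, Real.zero_rpow h1α.ne']
  have hL := fracRadiusValue_pos hα1
  obtain ⟨P, hP, hSP⟩ := intermediate_value_Icc hb0.le hcont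
    (show fracRadiusValue α ∈ Set.Icc (S 0) (S b) from ⟨hS0.le.trans hL.le, hb⟩)
  have hP1 : P < 1 := hP.2.trans_lt hb1
  have hP0 : 0 < P := by
    refine lt_of_le_of_ne hP.1 ?_
    rintro rfl
    linarith
  refine ⟨P, hP1, ⟨⟨hP0, ?_⟩, ?_⟩, ?_⟩
  · rw [← hSP]; exact hasSum_fracTerm hα1 hP0.le hP1
  · rintro r ⟨hr0, hr⟩
    by_contra! hlt
    have h1 := (hasSum_fracTerm hα1 hr0.le (hlt.trans hP1)).unique hr
    have h2 := hmono r P hr0.le hlt hP1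
    linarith
  · intro r hr0 hrP
    rcases hrP.eq_or_lt with rfl | h
    · exact hSP.le
    · exact (hmono r P hr0 h hP1).le.trans hSP.le

/-! ### Growth, behaviour at the centre and covering -/

/-- The support-line estimate multiplied by |z|^(1-α); both final inequalities rest on it. -/
theorem IsNormalizedConvexUnivalent.le_norm_fracDeriv {f : ℂ → ℂ}
    (hf : IsNormalizedConvexUnivalent f) {α : ℝ} (hα0 : 0 < α) (hα1 : α < 1) {ζ : ℂ}
    (hζ : ζ ∈ logDisc) :
    Real.exp ((1 - α) * ζ.re) * fracRadiusValue α ≤ ‖fracDeriv α f ζ‖ := by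
  have hΓ : 0 < (Real.Gamma (1 - α))⁻¹ := inv_pos.2 (Real.Gamma_pos_of_pos (by linarith))
  have h := hf.le_norm_integral hα0 hα1 (Complex.exp_ne_zero ζ) (norm_exp_lt_one hζ)
  have e : eulerIntegral α (-1) = ∫ u in (0 : ℝ)..1, (1 - u) ^ (-α) * ((1 + u) ^ 2)⁻¹ := by
    simp [eulerIntegral]
  rw [norm_fracDeriv hf.holomorphic hf.map_zero hα1 hζ, fracRadiusValue, e, mul_left_comm]
  gcongr

theorem tendsto_fracDeriv_toCentre {f : ℂ → ℂ} (hf : DifferentiableOn ℂ f (Metric.ball 0 1))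
    (hf0 : f 0 = 0) {α : ℝ} (hα1 : α < 1) : Tendsto (fracDeriv α f) toCentre (𝓝 0) := by
  obtain ⟨C, hC⟩ := exists_norm_fracDeriv_le hf hf0 hα1 (c := -1) (by norm_num)
  have h1 : Tendsto (fun ζ : ℂ => C * Real.exp ((1 - α) * ζ.re)) toCentre (𝓝 (C * 0)) := by
    refine Tendsto.const_mul _ (Real.tendsto_exp_atBot.comp ?_)
    exact (tendsto_comap (f := Complex.re)).const_mul_atBot (by linarith)
  rw [mul_zero] at h1
  refine squeeze_zero_norm' ?_ h1
  exact (tendsto_comap.eventually (eventually_le_atBot (-1 : ℝ))).mono fun ζ hζ => hC ζ hζ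

/-- The punctured disc is the exponential image of a half-plane. -/
theorem isPreconnected_ball_diff_zero {R : ℝ} (hR : 0 < R) :
    IsPreconnected (Metric.ball (0 : ℂ) R \ {0}) := by
  have h : Metric.ball (0 : ℂ) R \ {0} = Complex.exp '' {s : ℂ | s.re < Real.log R} := by
    ext w
    simp only [Set.mem_sdiff, Metric.mem_ball, dist_zero_right, Set.mem_singleton_iff,
      Set.mem_image, Set.mem_ofPred_eq]
    constructor
    · rintro ⟨h1, h2⟩
      refine ⟨Complex.log w, ?_, Complex.exp_log h2⟩
      rw [Complex.log_re]
      exact Real.log_lt_log (norm_pos_iff.2 h2) h1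
    · rintro ⟨s, hs, rfl⟩
      refine ⟨?_, Complex.exp_ne_zero s⟩
      rw [Complex.norm_exp, ← Real.exp_log hR]
      exact Real.exp_lt_exp.2 hs
  rw [h]
  exact (convex_halfSpace_re_lt _).isPreconnected.image _ Complex.continuous_exp.continuousOn

/-- Open mapping: a constant value would be 0 by the limit at the centre, but the growth bound
excludes 0. -/
theorem IsNormalizedConvexUnivalent.isOpen_fracDeriv_image {f : ℂ → ℂ}
    (hf : IsNormalizedConvexUnivalent f) {α : ℝ} (hα0 : 0 < α) (hα1 : α < 1) :
    IsOpen (fracDeriv α f '' logDisc) := by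
  have han : AnalyticOnNhd ℂ (fracDeriv α f) logDisc :=
    (differentiableOn_fracDeriv hf.holomorphic hf.map_zero hα1).analyticOnNhd isOpen_logDisc
  rcases han.is_constant_or_isOpen (convex_halfSpace_re_lt 0).isPreconnected with ⟨w, hw⟩ | h
  · exfalso
    have hm1 : (-1 : ℂ) ∈ logDisc := by simp [logDisc]
    have hpos : 0 < ‖w‖ := by
      rw [← hw _ hm1]
      exact (mul_pos (Real.exp_pos _) (fracRadiusValue_pos hα1)).trans_le
        (hf.le_norm_fracDeriv hα0 hα1 hm1)
    have hev : ∀ᶠ x : ℝ in atBot, fracDeriv α f (x : ℂ) = w := by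
      filter_upwards [eventually_lt_atBot (0 : ℝ)] with x hx
      exact hw _ (by simpa [logDisc] using hx)
    have ht : Tendsto (fun x : ℝ => (x : ℂ)) atBot toCentre := by
      rw [toCentre, tendsto_comap_iff]
      exact tendsto_id
    have h1 := (tendsto_fracDeriv_toCentre hf.holomorphic hf.map_zero hα1).comp ht
    have h2 : Tendsto (fracDeriv α f ∘ fun x : ℝ => (x : ℂ)) atBot (𝓝 w) :=
      tendsto_const_nhds.congr' (hev.mono fun x hx => hx.symm)
    rw [tendsto_nhds_unique h2 h1, norm_zero] at hpos
    exact lt_irrefl _ hpos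
  · exact h _ subset_rfl isOpen_logDisc

/-- The image is invariant under the change of branch. -/
theorem mul_mem_fracDeriv_image {f : ℂ → ℂ} (hf : DifferentiableOn ℂ f (Metric.ball 0 1))
    (hf0 : f 0 = 0) {α : ℝ} (hα1 : α < 1) (k : ℤ) {w : ℂ} (hw : w ∈ fracDeriv α f '' logDisc) :
    Complex.exp (((1 - α) * (k * (2 * Real.pi)) : ℝ) * Complex.I) * w ∈
      fracDeriv α f '' logDisc := by
  obtain ⟨ζ, hζ, rfl⟩ := hw
  refine ⟨ζ + k * (2 * Real.pi * Complex.I), ?_, fracDeriv_add_two_pi hf hf0 hα1 hζ k⟩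
  simpa [logDisc] using hζ

/-- The covering theorem: the image contains the disc whose radius is the limiting value at `-1`
of the fractional derivative of `z / (1 - z)`. -/
theorem IsNormalizedConvexUnivalent.ball_subset_fracImage {f : ℂ → ℂ}
    (hf : IsNormalizedConvexUnivalent f) {α : ℝ} (hα0 : 0 < α) (hα1 : α < 1) :
    Metric.ball 0 (fracRadiusValue α) ⊆ fracImage α f 0 := by
  set L := fracRadiusValue α with hL
  have hL0 : 0 < L := fracRadiusValue_pos hα1
  set E := fracDeriv α f '' logDisc with hE
  have hEo : IsOpen E := hf.isOpen_fracDeriv_image hα0 hα1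
  have h1α : 0 < 1 - α := by linarith
  have hsmall : ∀ ε > 0, ∃ a : ℝ, ∀ ζ : ℂ, ζ.re ≤ a → ‖fracDeriv α f ζ‖ < ε := by
    intro ε hε
    have h := (tendsto_fracDeriv_toCentre hf.holomorphic hf.map_zero hα1).eventually
      (Metric.ball_mem_nhds 0 hε)
    rw [toCentre, eventually_comap] at h
    obtain ⟨a, ha⟩ := eventually_atBot.1 h
    exact ⟨a, fun ζ hζ => by simpa using ha ζ.re hζ ζ rfl⟩
  have hsub : Metric.ball 0 L \ {0} ⊆ E := by
    -- Connectedness argument: the open set E meets the punctured disc and contains each of its own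
    -- limit points lying there.
    refine (isPreconnected_ball_diff_zero hL0).subset_of_closure_inter_subset hEo ?_ ?_
    · obtain ⟨a, ha⟩ := hsmall L hL0
      have hm : ((min a (-1) : ℝ) : ℂ) ∈ logDisc := by
        simp [logDisc]
      refine ⟨fracDeriv α f ((min a (-1) : ℝ) : ℂ), ⟨?_, ?_⟩, _, hm, rfl⟩
      · simpa using ha ((min a (-1) : ℝ) : ℂ) (by simp)
      · refine norm_pos_iff.1 ?_
        exact (mul_pos (Real.exp_pos _) hL0).trans_le (hf.le_norm_fracDeriv hα0 hα1 hm)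
    · rintro w ⟨hwc, hwL, hw0⟩
      have hw0' : 0 < ‖w‖ := norm_pos_iff.2 hw0
      have hwL' : ‖w‖ < L := by simpa using hwL
      obtain ⟨η, hη1, hη2⟩ := exists_between hwL'
      obtain ⟨a, ha⟩ := hsmall (‖w‖ / 2) (by positivity)
      -- Beyond Re ζ = c the growth bound forces modulus above η > ‖w‖; below Re ζ = a the modulus
      -- is under ‖w‖/2. Values near w thus come from a vertical strip.
      obtain ⟨c, hc, hc0⟩ : ∃ c : ℝ, η < Real.exp ((1 - α) * c) * L ∧ c < 0 := by
        have ht : ContinuousAt (fun c : ℝ => Real.exp ((1 - α) * c) * L) 0 := by fun_prop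
        have ht' := ht.tendsto.mono_left (nhdsWithin_le_nhds (s := Set.Iio 0))
        exact ((ht'.eventually_const_lt (by simpa using hη2)).and self_mem_nhdsWithin).exists
      set Q : Set ℂ := Set.Icc a c ×ℂ Set.Icc 0 (2 * Real.pi) with hQ
      have hQc : IsCompact Q := isCompact_Icc.reProdIm isCompact_Icc
      have hQD : Q ⊆ logDisc := fun ζ hζ => hζ.1.2.trans_lt hc0
      have hcont : ContinuousOn (fracDeriv α f) Q :=
        (differentiableOn_fracDeriv hf.holomorphic hf.map_zero hα1).continuousOn.mono hQD
      -- Compactness gives one δ for all of Q, fixed before the approximating ζ is chosen and so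
      -- independent of its branch.
      obtain ⟨δ, hδ, hthick⟩ := (hQc.image_of_continuousOn hcont).exists_thickening_subset_open
        hEo (Set.image_mono hQD)
      obtain ⟨_, ⟨ζ, hζ, rfl⟩, hdist⟩ := Metric.mem_closure_iff.1 hwc
        (min δ (min (η - ‖w‖) (‖w‖ / 2)))
        (lt_min hδ (lt_min (by linarith) (by positivity)))
      rw [dist_eq_norm] at hdist
      have hd1 := hdist.trans_le (min_le_left _ _)
      have hd2 := hdist.trans_le ((min_le_right _ _).trans (min_le_left _ _))
      have hd3 := hdist.trans_le ((min_le_right _ _).trans (min_le_right _ _))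
      have hub : ‖fracDeriv α f ζ‖ < η := by
        have := norm_sub_norm_le (fracDeriv α f ζ) w
        rw [norm_sub_rev] at this
        linarith
      have hlb : ‖w‖ / 2 < ‖fracDeriv α f ζ‖ := by
        have := norm_sub_norm_le w (fracDeriv α f ζ)
        linarith
      have hrea : a ≤ ζ.re := by
        by_contra! h
        linarith [ha ζ h.le]
      have hrec : ζ.re ≤ c := by
        by_contra! h
        have h1 := hf.le_norm_fracDeriv hα0 hα1 hζ
        have h2 : Real.exp ((1 - α) * c) * L ≤ Real.exp ((1 - α) * ζ.re) * L := by gcongr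
        linarith
      have h2π : 0 < 2 * Real.pi := by positivity
      -- Shifting ζ into Q rotates its value by e; the rotated point e w is then within δ of the
      -- image of Q, and rotating back returns w to E.
      set k : ℤ := ⌊ζ.im / (2 * Real.pi)⌋ with hk
      set ζ' : ℂ := ζ + ((-k : ℤ) : ℂ) * (2 * Real.pi * Complex.I) with hζ'
      have hre : ζ'.re = ζ.re := by simp [hζ']
      have him : ζ'.im = ζ.im - k * (2 * Real.pi) := by simp [hζ']; ring
      have hmem : ζ' ∈ Q := by
        have h1 := Int.floor_le (ζ.im / (2 * Real.pi))
        have h2 := (Int.lt_floor_add_one (ζ.im / (2 * Real.pi))).le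
        rw [← hk] at h1 h2
        rw [le_div_iff₀ h2π] at h1
        rw [div_le_iff₀ h2π] at h2
        refine ⟨?_, ?_⟩
        · change ζ'.re ∈ Set.Icc a c
          rw [hre]; exact ⟨hrea, hrec⟩
        · change ζ'.im ∈ Set.Icc 0 (2 * Real.pi)
          rw [him]; constructor <;> linarith
      have hFζ' := fracDeriv_add_two_pi hf.holomorphic hf.map_zero hα1 hζ (-k)
      rw [← hζ'] at hFζ'
      set e := Complex.exp (((1 - α) * (((-k : ℤ) : ℝ) * (2 * Real.pi)) : ℝ) * Complex.I) with he
      have hen : ‖e‖ = 1 := Complex.norm_exp_ofReal_mul_I _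
      have hew : e * w ∈ E := by
        apply hthick
        rw [Metric.mem_thickening_iff]
        refine ⟨_, ⟨ζ', hmem, rfl⟩, ?_⟩
        rw [hFζ', dist_eq_norm, ← mul_sub, norm_mul, hen, one_mul]
        exact hd1
      have hback := mul_mem_fracDeriv_image hf.holomorphic hf.map_zero hα1 k hew
      rw [← mul_assoc, he, ← Complex.exp_add] at hback
      have hz : (((1 - α) * (k * (2 * Real.pi)) : ℝ) : ℂ) * Complex.I +
          (((1 - α) * (((-k : ℤ) : ℝ) * (2 * Real.pi)) : ℝ) : ℂ) * Complex.I = 0 := by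
        push_cast; ring
      rwa [hz, Complex.exp_zero, one_mul] at hback
  intro w hw
  by_cases h : w = 0
  · exact Or.inl h
  · exact Or.inr (hsub ⟨hw, h⟩)

/-! ### Distance to the boundary, liminf at the circle, conclusion -/

/-- A ball inside s lies in its interior and misses the frontier. An empty frontier is covered, as
the extended distance to it is `⊤`. -/
theorem le_infEDist_frontier_of_ball_subset {s : Set ℂ} {w : ℂ} {R : ℝ}
    (h : Metric.ball w R ⊆ s) : ENNReal.ofReal R ≤ Metric.infEDist w (frontier s) := by
  refine Metric.le_infEDist.2 fun y hy => ?_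
  have hy' : y ∉ Metric.ball w R := fun hmem =>
    hy.2 (interior_maximal h Metric.isOpen_ball hmem)
  rw [edist_dist, dist_comm]
  exact ENNReal.ofReal_le_ofReal (not_lt.1 hy')

theorem IsNormalizedConvexUnivalent.le_liminf_fracDeriv {f : ℂ → ℂ}
    (hf : IsNormalizedConvexUnivalent f) {α : ℝ} (hα0 : 0 < α) (hα1 : α < 1) :
    ENNReal.ofReal (fracRadiusValue α) ≤
      liminf (fun ζ : ℂ => edist (fracDeriv α f ζ) 0) toCircle := by
  -- Nontriviality of the filter is needed for a limit to coincide with its liminf.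
  have hne : toCircle.NeBot := by
    refine comap_neBot fun t ht => ?_
    obtain ⟨x, hx⟩ := (inferInstance : (𝓝[<] (0 : ℝ)).NeBot).nonempty_of_mem ht
    exact ⟨(x : ℂ), by simpa using hx⟩
  have ht : Tendsto (fun ζ : ℂ =>
      ENNReal.ofReal (Real.exp ((1 - α) * ζ.re) * fracRadiusValue α)) toCircle
      (𝓝 (ENNReal.ofReal (fracRadiusValue α))) := by
    have hc : Tendsto (fun x : ℝ => Real.exp ((1 - α) * x) * fracRadiusValue α) (𝓝[<] 0)
        (𝓝 (fracRadiusValue α)) := by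
      have : ContinuousAt (fun x : ℝ => Real.exp ((1 - α) * x) * fracRadiusValue α) 0 := by
        fun_prop
      simpa using this.tendsto.mono_left (nhdsWithin_le_nhds (s := Set.Iio 0))
    exact ENNReal.tendsto_ofReal (hc.comp tendsto_comap)
  rw [← ht.liminf_eq]
  refine liminf_le_liminf ?_
  have hev : ∀ᶠ ζ in toCircle, ζ ∈ logDisc := tendsto_comap.eventually self_mem_nhdsWithin
  filter_upwards [hev] with ζ hζ
  rw [edist_dist, dist_zero_right]
  exact ENNReal.ofReal_le_ofReal (hf.le_norm_fracDeriv hα0 hα1 hζ)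

theorem theorem3p8 (α : ℝ) (hα0 : 0 < α) (hα1 : α < 1) :
    ∃ L P : ℝ,
      Tendsto (fun t : ℝ => |t ^ (1 - α) / Real.Gamma (2 - α) *
        ordinaryHypergeometric (1 : ℝ) 2 (2 - α) (-t)|) (𝓝[<] 1) (𝓝 L) ∧
      IsLeast {r : ℝ | 0 < r ∧ HasSum (fun n : ℕ => fracTerm α r (n + 1)) L} P ∧
      P < 1 ∧
      ∀ (f : ℂ → ℂ) (a : ℕ → ℂ), IsNormalizedConvexUnivalent f →
        (∀ z ∈ Metric.ball (0 : ℂ) 1, HasSum (fun n : ℕ => a n * z ^ n) (f z)) →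
        ∃ w₀ : ℂ, Tendsto (fracDeriv α f) toCentre (𝓝 w₀) ∧
          ∀ r : ℝ, 0 ≤ r → r ≤ P →
            Summable (fun n : ℕ => fracTerm α r (n + 1) * ‖a (n + 1)‖) ∧
            ENNReal.ofReal (fracMajorant α a r) ≤
              Metric.infEDist w₀ (frontier (fracImage α f w₀)) ∧
            ENNReal.ofReal (fracMajorant α a r) ≤
              liminf (fun ζ : ℂ => edist (fracDeriv α f ζ) w₀) toCircle := by
  obtain ⟨P, hP1, hPleast, hPle⟩ := exists_radius hα1
  refine ⟨fracRadiusValue α, P, tendsto_fracRadiusValue hα1, hPleast, hP1, fun f a hf ha => ?_⟩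
  refine ⟨0, tendsto_fracDeriv_toCentre hf.holomorphic hf.map_zero hα1, fun r hr0 hrP => ?_⟩
  have hsum := hasSum_fracTerm hα1 hr0 (hrP.trans_lt hP1)
  have hnn : ∀ n : ℕ, 0 ≤ fracTerm α r (n + 1) := by
    intro n
    have h1 : 0 < ((n + 1 : ℕ) : ℝ) + 1 - α := by push_cast; linarith [n.cast_nonneg (α := ℝ)]
    exact mul_nonneg (div_nonneg (Real.Gamma_pos_of_pos (by positivity)).le
      (Real.Gamma_pos_of_pos h1).le) (Real.rpow_nonneg hr0 _)
  have hle : ∀ n : ℕ, fracTerm α r (n + 1) * ‖a (n + 1)‖ ≤ fracTerm α r (n + 1) := fun n =>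
    mul_le_of_le_one_right (hnn n) (hf.norm_coeff_le_one ha n.succ_ne_zero)
  have hsummable : Summable (fun n : ℕ => fracTerm α r (n + 1) * ‖a (n + 1)‖) :=
    hsum.summable.of_nonneg_of_le (fun n => mul_nonneg (hnn n) (norm_nonneg _)) hle
  have hmaj : fracMajorant α a r ≤ fracRadiusValue α :=
    (hasSum_le hle hsummable.hasSum hsum).trans (hPle r hr0 hrP)
  exact ⟨hsummable,
    (ENNReal.ofReal_le_ofReal hmaj).trans
      (le_infEDist_frontier_of_ball_subset (hf.ball_subset_fracImage hα0 hα1)),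
    (ENNReal.ofReal_le_ofReal hmaj).trans (hf.le_liminf_fracDeriv hα0 hα1)⟩
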